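/- Let $\mathcal A$ be a finite alphabet, $d:\mathcal A\times\mathcal A\to[0,\infty)$ a distortion function, extended additively to sequences by $d(\mathbf x,\mathbf y)=\sum_{i=1}^n d(x_i,y_i)$, let $P_0,P_1$ be probability mass functions on $\mathcal A$ with $P_0\ll P_1$, let $\lambda>0$, and let $\Delta_0,\Delta_1$ be distortion levels such that every letter $a$ has, for $i=0,1$, some letter $b$ with $d(a,b)\le\Delta_i$ (i.e. admissible attack channels exist). For $\mathbf x\in\mathcal A^n$ let $\hat P_{\mathbf x}$ be its empirical distribution and $P_i(\mathbf x)=\prod_j P_i(x_j)$; let $\mathcal T(\mathbf y|\mathbf x)$ be the set of $\mathbf y'$ such that $(\mathbf x,\mathbf y')$ has the same joint empirical distribution as $(\mathbf x,\mathbf y)$. Let $D(\cdot\|\cdot)$ be the Kullback–Leibler divergence (natural logarithm, values in $[0,+\infty]$); minima over the empty set are $+\infty$. Consider the equilibrium profile of the Neyman–Pearson detection game. The defender's decision rule $\Phi^*$ decides for $H_1$ with probability $$\Phi^*(H_1|\mathbf y)=\exp\Big\{-n\big[\lambda-\min_{\mathbf x:\,d(\mathbf x,\mathbf y)\le n\Delta_0}D(\hat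 P_{\mathbf x}\|P_0)\big]_+\Big\},\qquad \Phi^*(H_0|\mathbf y)=1-\Phi^*(H_1|\mathbf y).$$ The attack channel under $H_1$ is $A^*_{\Delta_1}(\mathbf y|\mathbf x)=c_n(\mathbf x)/|\mathcal T(\mathbf y|\mathbf x)|$ if $d(\mathbf x,\mathbf y)\le n\Delta_1$, and $0$ otherwise, where $1/c_n(\mathbf x)$ is the number of classes $\mathcal T(\mathbf y|\mathbf x)$ with $d(\mathbf x,\mathbf y)\le n\Delta_1$. The false-negative probability is $$P_{FN}(\Phi^*,A^*_{\Delta_1})=\sum_{\mathbf y}\sum_{\mathbf x}P_1(\mathbf x)A^*_{\Delta_1}(\mathbf y|\mathbf x)\Phi^*(H_0|\mathbf y).$$ For probability mass functions $P_Y,P$ on $\mathcal A$ put $$\tilde D_\Delta(P_Y,P)=\min_{P_{X|Y}:\ E_{XY}d(X,Y)\le\Delta}D(P_X\|P),$$ where $P_X$ is the law of $X$ when $(X,Y)\sim P_YP_{X|Y}$. Then, for $(\Delta,P)=(\Delta_0,P_0)$ and $(\Delta_1,P_1)$, the minimum defining $\tilde D_\Delta(P_Y,P)$ is attained whenever its feasible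 set is non-empty; $P_{FN}(\Phi^*,A^*_{\Delta_1})>0$ for all large $n$; the limit of $\frac1n\ln P_{FN}(\Phi^*,A^*_{\Delta_1})$ exists; and the false-negative exponent $\varepsilon_{FN}(\lambda)=-\limsup_{n\to\infty}\frac1n\ln P_{FN}(\Phi^*,A^*_{\Delta_1})$ satisfies $$\varepsilon_{FN}(\lambda)=-\lim_{n\to\infty}\frac1n\ln P_{FN}(\Phi^*,A^*_{\Delta_1})=\min_{P_Y:\ \tilde D_{\Delta_0}(P_Y,P_0)\le\lambda}\tilde D_{\Delta_1}(P_Y,P_1),$$ where the outer minimum is attained and finite. -/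

import Mathlib

open Filter Topology Finset

namespace DetectionGame

section Defs

variable {A : Type*} [Fintype A]

/-- Kullback-Leibler divergence `D(p ‖ q)` (natural logarithm) of probability vectors on a finite
alphabet, with value `+∞` when `p` is not absolutely continuous with respect to `q`.
The terms with `p a = 0` vanish. -/
noncomputable def divergence (p q : A → ℝ) : EReal :=
  open Classical in
  if ∀ a, q a = 0 → p a = 0 then ((∑ a, p a * Real.log (p a / q a) : ℝ) : EReal) else ⊤

/-- The channels `W = P_{X|Y}` (rows indexed by `y`) with `E_{XY} d(X,Y) ≤ Δ`, where `Y ∼ PY`. -/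
def feasibleChannels (d : A → A → ℝ) (Δ : ℝ) (PY : A → ℝ) : Set (A → A → ℝ) :=
  {W | (∀ y, W y ∈ stdSimplex ℝ A) ∧ ∑ x, ∑ y, PY y * W y x * d x y ≤ Δ}

/-- The law `P_X` of `X` when `Y ∼ PY` and `P_{X|Y} = W`. -/
def outputLaw (PY : A → ℝ) (W : A → A → ℝ) : A → ℝ := fun x => ∑ y, PY y * W y x

/-- `D̃_Δ(P_Y, P)`: the minimum of `D(P_X ‖ P)` over the channels `P_{X|Y}` with
`E_{XY} d(X,Y) ≤ Δ` (equal to `+∞` if there is no such channel). -/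
noncomputable def tildeD (d : A → A → ℝ) (Δ : ℝ) (PY P : A → ℝ) : EReal :=
  ⨅ W ∈ feasibleChannels d Δ PY, divergence (outputLaw PY W) P

/-- The empirical distribution (type) of a sequence of length `n`. -/
noncomputable def empirical {B : Type*} {n : ℕ} (x : Fin n → B) : B → ℝ :=
  open Classical in
  fun b => ((univ.filter fun i => x i = b).card : ℝ) / n

/-- The additive distortion between sequences. -/
def seqDist {n : ℕ} (d : A → A → ℝ) (x y : Fin n → A) : ℝ := ∑ i, d (x i) (y i)

/-- The probability of a sequence emitted by the memoryless source `P`. -/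
def seqProb {n : ℕ} (P : A → ℝ) (x : Fin n → A) : ℝ := ∏ i, P (x i)

/-- The conditional type class `T(y|x)`: all `y'` such that `(x, y')` and `(x, y)` have the same
joint type. -/
noncomputable def condTypeClass {n : ℕ} (x y : Fin n → A) : Finset (Fin n → A) :=
  open Classical in
  univ.filter fun y' =>
    empirical (fun i => (x i, y' i)) = empirical (fun i => (x i, y i))

/-- The number of conditional type classes `T(y|x)` with `d(x,y) ≤ nΔ`. -/
noncomputable def numAdmissible {n : ℕ} (d : A → A → ℝ) (Δ : ℝ) (x : Fin n → A) : ℕ :=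
  open Classical in
  ((univ.filter fun y => seqDist d x y ≤ n * Δ).image fun y => condTypeClass x y).card

/-- The attack channel `A*_Δ(y|x)`: given `x`, choose uniformly one of the admissible conditional
type classes, and then `y` uniformly in that class. -/
noncomputable def attack {n : ℕ} (d : A → A → ℝ) (Δ : ℝ) (x y : Fin n → A) : ℝ :=
  open Classical in
  if seqDist d x y ≤ n * Δ then
    ((numAdmissible d Δ x : ℝ))⁻¹ / ((condTypeClass x y).card : ℝ)
  else 0

/-- The exponent `[lam - min_{x : d(x,y) ≤ nΔ₀} D(P̂_x ‖ P₀)]_+`; a minimum over the empty set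
is `+∞`. -/
noncomputable def defenceRate {n : ℕ} (d : A → A → ℝ) (Δ₀ : ℝ) (P₀ : A → ℝ) (lam : ℝ)
    (y : Fin n → A) : EReal :=
  max ((lam : EReal) -
    ⨅ x ∈ {x : Fin n → A | seqDist d x y ≤ n * Δ₀}, divergence (empirical x) P₀) 0

/-- The randomized decision rule `Φ*`: the entry `defence d Δ₀ P₀ lam h y` is the probability
`Φ*(H_h | y)` of deciding for the hypothesis `H_h` (`h = 0, 1`) when `y` is observed. -/
noncomputable def defence {n : ℕ} (d : A → A → ℝ) (Δ₀ : ℝ) (P₀ : A → ℝ) (lam : ℝ)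
    (h : Fin 2) (y : Fin n → A) : ℝ :=
  if h = 1 then Real.exp (-(n * (defenceRate d Δ₀ P₀ lam y).toReal))
  else 1 - Real.exp (-(n * (defenceRate d Δ₀ P₀ lam y).toReal))

/-- The false-negative probability `∑_y Q₁(y) Φ(H₀|y)` with `Q₁(y) = ∑_x P₁(x) A₁(y|x)`, for a
decision rule `Φ` and an attack channel `A₁` (written `A₁ x y` for `A₁(y|x)`). -/
def falseNegative {n : ℕ} (P₁ : A → ℝ) (Φ : Fin 2 → (Fin n → A) → ℝ)
    (A₁ : (Fin n → A) → (Fin n → A) → ℝ) : ℝ :=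
  ∑ y, (∑ x, seqProb P₁ x * A₁ x y) * Φ 0 y

/-- The false-negative probability at block length `n` of the profile `(Φ*, A*_{Δ₁})`. -/
noncomputable def equilibriumFN (d : A → A → ℝ) (Δ₀ Δ₁ : ℝ) (P₀ P₁ : A → ℝ) (lam : ℝ)
    (n : ℕ) : ℝ :=
  falseNegative (n := n) P₁ (defence d Δ₀ P₀ lam) (attack d Δ₁)

end Defs

/-- The error exponent `- limsup (ln p_n) / n` of a sequence of probabilities
(with `ln 0 = -∞`). -/
noncomputable def errorExponent (p : ℕ → ℝ) : EReal :=
  - limsup (fun n : ℕ => ENNReal.log (ENNReal.ofReal (p n)) / ((n : ℝ) : EReal)) atTop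

end DetectionGame

/-! The proof is the method of types, organised around joint laws of triples `(X₀, X₁, Y)`. The set
`couplings` consists of the laws with `E d(Xᵢ, Y) ≤ Δᵢ` and `Xᵢ` supported in the support of `Pᵢ`.
The exponent is the least `D(P_{X₁} ‖ P₁)` over couplings with `D(P_{X₀} ‖ P₀) ≤ lam`. This set is
compact and the real sum `klSum` is continuous, so the least value is attained and real. Two
channels out of the same `Y` can be glued into a coupling, and a coupling can be disintegrated into
two channels, so this is the stated min-min problem (`isLeast_tildeD`).

Upper bound on the probability (`equilibriumFN_le`): if a pair `(x, y)` contributes, some `x₀` near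
`y` has type divergence below `lam`. The joint type of `(x₀, x, y)` is then a coupling, so the
divergence of the type of `x` is at least the optimum. Only polynomially many types occur.

Lower bound (`le_equilibriumFN`): one good triple of sequences suffices, because everything is
invariant under permuting positions. Its orbit supplies the whole type class of `x` and, for each
member, a whole conditional type class of attacked sequences accepted with high probability; each
costs only a polynomial factor.

The difficulty is to find types that satisfy the distortion constraints exactly while approaching
the optimum. The optimal coupling is mixed with a little of a regularizing one
(`exists_regularizer`). After that each constraint is either strict, hence stable under
approximation, or an equality at every letter of the support, hence true of every sequence over that
support. The dichotomy comes from `slack₀_or_tight` and `slack₁_or_tight`. -/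

namespace DetectionGame

/-! ### Divergence: continuity, convexity, and attainment of `tildeD`. -/

section Divergence

variable {A : Type*} [Fintype A]

/-- The real-valued divergence sum, meaningful when `p` is absolutely continuous w.r.t. `q`. -/
noncomputable def klSum (p q : A → ℝ) : ℝ := ∑ a, p a * Real.log (p a / q a)

lemma divergence_of_ac {p q : A → ℝ} (h : ∀ a, q a = 0 → p a = 0) :
    divergence p q = (klSum p q : EReal) := by
  unfold divergence klSum
  rw [if_pos h]

lemma divergence_of_not_ac {p q : A → ℝ} (h : ¬ ∀ a, q a = 0 → p a = 0) :
    divergence p q = ⊤ := by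
  unfold divergence
  rw [if_neg h]

/-- With `x / 0 = 0`, the terms where `q a = 0` vanish identically, so continuity needs no absolute
continuity. The latter is imposed separately, as a closed support condition. -/
lemma continuous_klSum (q : A → ℝ) : Continuous fun p : A → ℝ => klSum p q := by
  unfold klSum
  refine continuous_finsetSum _ fun a _ => ?_
  by_cases h : q a = 0
  · simp only [h, div_zero, Real.log_zero, mul_zero]
    exact continuous_const
  · have e : (fun p : A → ℝ => p a * Real.log (p a / q a)) =
        fun p : A → ℝ => q a * ((p a / q a) * Real.log (p a / q a)) := by
      funext p
      field_simp
    rw [e]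
    exact continuous_const.mul
      (Real.continuous_mul_log.comp ((continuous_apply a).div_const _))

lemma klSum_mix_le {p p' q : A → ℝ} (hp : ∀ a, 0 ≤ p a) (hp' : ∀ a, 0 ≤ p' a)
    (hq : ∀ a, 0 ≤ q a) {t : ℝ} (ht : 0 ≤ t) (ht' : t ≤ 1) :
    klSum ((1 - t) • p + t • p') q ≤ (1 - t) * klSum p q + t * klSum p' q := by
  unfold klSum
  rw [mul_sum, mul_sum, ← sum_add_distrib]
  refine sum_le_sum fun a _ => ?_
  simp only [Pi.add_apply, Pi.smul_apply, smul_eq_mul]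
  rcases (hq a).eq_or_lt with h | h
  · simp [← h]
  · have key := Real.convexOn_mul_log.2 (x := p a / q a) (y := p' a / q a)
      (Set.mem_Ici.2 (div_nonneg (hp a) h.le)) (Set.mem_Ici.2 (div_nonneg (hp' a) h.le))
      (sub_nonneg.2 ht') ht (by ring)
    simp only [smul_eq_mul] at key
    have e : (1 - t) * (p a / q a) + t * (p' a / q a) = ((1 - t) * p a + t * p' a) / q a := by
      field_simp
    rw [e] at key
    have := mul_le_mul_of_nonneg_left key h.le
    calc _ = q a * (((1 - t) * p a + t * p' a) / q a *
              Real.log (((1 - t) * p a + t * p' a) / q a)) := by field_simp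
      _ ≤ _ := this
      _ = _ := by field_simp

lemma klSum_nonneg {p q : A → ℝ} (hp : p ∈ stdSimplex ℝ A) (hq : q ∈ stdSimplex ℝ A)
    (h : ∀ a, q a = 0 → p a = 0) : 0 ≤ klSum p q := by
  have : ∑ a, (p a - q a) ≤ klSum p q := by
    refine sum_le_sum fun a _ => ?_
    rcases (hp.1 a).eq_or_lt with h0 | h0
    · rw [← h0]
      have := hq.1 a
      simp [this]
    · have hqa : 0 < q a := lt_of_le_of_ne (hq.1 a) fun e => h0.ne' (h a e.symm)
      have := Real.one_sub_inv_le_log_of_pos (div_pos h0 hqa)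
      have := mul_le_mul_of_nonneg_left this h0.le
      calc p a - q a = p a * (1 - (p a / q a)⁻¹) := by field_simp
        _ ≤ _ := this
  rw [sum_sub_distrib, hp.2, hq.2, sub_self] at this
  exact this

lemma divergence_nonneg {p q : A → ℝ} (hp : p ∈ stdSimplex ℝ A) (hq : q ∈ stdSimplex ℝ A) :
    0 ≤ divergence p q := by
  by_cases h : ∀ a, q a = 0 → p a = 0
  · rw [divergence_of_ac h]
    exact_mod_cast klSum_nonneg hp hq h
  · rw [divergence_of_not_ac h]
    exact le_top

lemma klSum_self (p : A → ℝ) : klSum p p = 0 := by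
  unfold klSum
  refine sum_eq_zero fun a _ => ?_
  by_cases h : p a = 0
  · simp [h]
  · simp [div_self h]

/-- Channels attaining `D̃_Δ(P_Y, P)` exist as soon as there is a feasible channel. -/
lemma exists_channel_eq_tildeD (d : A → A → ℝ) (Δ : ℝ) (PY P : A → ℝ)
    (hne : (feasibleChannels d Δ PY).Nonempty) :
    ∃ W ∈ feasibleChannels d Δ PY, divergence (outputLaw PY W) P = tildeD d Δ PY P := by
  suffices h : ∃ W ∈ feasibleChannels d Δ PY, ∀ V ∈ feasibleChannels d Δ PY,
      divergence (outputLaw PY W) P ≤ divergence (outputLaw PY V) P by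
    obtain ⟨W, hW, hmin⟩ := h
    exact ⟨W, hW, le_antisymm (le_iInf₂ hmin) (iInf₂_le W hW)⟩
  have hout : Continuous fun W : A → A → ℝ => outputLaw PY W := by
    unfold outputLaw
    fun_prop
  -- On `S` the divergence is the continuous `klSum`, so compactness gives a minimizer; off `S` it
  -- is `⊤`. If `S` is empty, every feasible channel is optimal with value `⊤`.
  set S : Set (A → A → ℝ) := feasibleChannels d Δ PY ∩
    {W | ∀ a, P a = 0 → outputLaw PY W a = 0} with hS
  have hcl : IsClosed {W : A → A → ℝ | ∀ a, P a = 0 → outputLaw PY W a = 0} := by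
    simp only [Set.ofPred_forall]
    exact isClosed_iInter fun a => isClosed_iInter fun _ =>
      isClosed_eq ((continuous_apply a).comp hout) continuous_const
  have hfe : IsCompact (feasibleChannels d Δ PY) := by
    have h1 : IsCompact (Set.univ.pi fun _ : A => stdSimplex ℝ A) :=
      isCompact_univ_pi fun _ => isCompact_stdSimplex ℝ A
    have h2 : IsClosed {W : A → A → ℝ | ∑ x, ∑ y, PY y * W y x * d x y ≤ Δ} :=
      isClosed_le (by fun_prop) continuous_const
    have : feasibleChannels d Δ PY = (Set.univ.pi fun _ : A => stdSimplex ℝ A) ∩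
        {W : A → A → ℝ | ∑ x, ∑ y, PY y * W y x * d x y ≤ Δ} := by
      ext W
      simp only [feasibleChannels, Set.mem_ofPred_eq, Set.mem_inter_iff, Set.mem_univ_pi]
    rw [this]
    exact h1.inter_right h2
  have hcomp : IsCompact S := hfe.inter_right hcl
  rcases S.eq_empty_or_nonempty with he | hSne
  · obtain ⟨W, hW⟩ := hne
    refine ⟨W, hW, fun V hV => ?_⟩
    have : divergence (outputLaw PY V) P = ⊤ := by
      refine divergence_of_not_ac fun h => ?_
      have : V ∈ S := ⟨hV, h⟩
      rw [he] at this
      exact this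
    rw [this]
    exact le_top
  · obtain ⟨W, hW, hmin⟩ := hcomp.exists_isMinOn hSne
      (((continuous_klSum P).comp hout).continuousOn)
    refine ⟨W, hW.1, fun V hV => ?_⟩
    by_cases h : ∀ a, P a = 0 → outputLaw PY V a = 0
    · rw [divergence_of_ac h, divergence_of_ac hW.2]
      exact_mod_cast hmin (show V ∈ S from ⟨hV, h⟩)
    · rw [divergence_of_not_ac h]
      exact le_top

end Divergence

/-! ### Image weights, used for marginals of joint laws. -/

section Marginals

variable {B C : Type*} [Fintype B]

/-- The image under `f` of the weight function `R`. -/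
noncomputable def pushWeight (f : B → C) (R : B → ℝ) : C → ℝ :=
  open Classical in fun c => ∑ b, if f b = c then R b else 0

lemma continuous_pushWeight (f : B → C) : Continuous (pushWeight f) := by
  classical
  unfold pushWeight
  refine continuous_pi fun c => continuous_finsetSum _ fun b _ => ?_
  split_ifs
  · exact continuous_apply b
  · exact continuous_const

lemma pushWeight_mix (f : B → C) (R R' : B → ℝ) (t : ℝ) :
    pushWeight f ((1 - t) • R + t • R') = (1 - t) • pushWeight f R + t • pushWeight f R' := by
  classical
  funext c
  simp only [pushWeight, Pi.add_apply, Pi.smul_apply, smul_eq_mul, mul_sum, ← sum_add_distrib]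
  refine sum_congr rfl fun b _ => ?_
  split_ifs <;> simp

lemma sum_pushWeight [Fintype C] (f : B → C) (R : B → ℝ) (g : C → ℝ) :
    ∑ c, pushWeight f R c * g c = ∑ b, R b * g (f b) := by
  classical
  simp only [pushWeight, sum_mul, ite_mul, zero_mul]
  rw [sum_comm]
  simp

lemma pushWeight_mem_stdSimplex [Fintype C] (f : B → C) {R : B → ℝ} (hR : R ∈ stdSimplex ℝ B) :
    pushWeight f R ∈ stdSimplex ℝ C := by
  classical
  refine ⟨fun c => sum_nonneg fun b _ => ?_, ?_⟩
  · split_ifs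
    · exact hR.1 b
    · exact le_rfl
  · have := sum_pushWeight f R fun _ => 1
    simp only [mul_one] at this
    rw [this, hR.2]

lemma pushWeight_eq_zero (f : B → C) {R : B → ℝ} {c : C} (h : ∀ b, f b = c → R b = 0) :
    pushWeight f R c = 0 := by
  classical
  refine sum_eq_zero fun b _ => ?_
  split_ifs with hb
  · exact h b hb
  · rfl

end Marginals

/-! ### The method of types. -/

section Types

variable {B C : Type*} {n : ℕ}

/-- The number of occurrences of `b` in the sequence `x`. -/
noncomputable def letterCount (x : Fin n → B) (b : B) : ℕ :=
  open Classical in (univ.filter fun i => x i = b).card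

lemma empirical_apply (x : Fin n → B) (b : B) : empirical x b = (letterCount x b : ℝ) / n := rfl

lemma letterCount_le (x : Fin n → B) (b : B) : letterCount x b ≤ n := by
  classical
  exact (card_le_univ _).trans_eq (Fintype.card_fin n)

lemma empirical_nonneg (x : Fin n → B) (b : B) : 0 ≤ empirical x b := by
  rw [empirical_apply]
  positivity

lemma letterCount_pos_iff {x : Fin n → B} {b : B} : 0 < letterCount x b ↔ ∃ i, x i = b := by
  classical
  simp [letterCount, card_pos, Finset.Nonempty]

lemma empirical_ne_zero_iff {x : Fin n → B} {b : B} : empirical x b ≠ 0 ↔ ∃ i, x i = b := by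
  rw [← letterCount_pos_iff, empirical_apply]
  constructor
  · intro h
    exact Nat.pos_of_ne_zero fun h0 => h (by simp [h0])
  · intro h
    have hn : 0 < n := h.trans_le (letterCount_le x b)
    positivity

lemma empirical_pos (x : Fin n → B) (i : Fin n) : 0 < empirical x (x i) :=
  lt_of_le_of_ne (empirical_nonneg x _) (empirical_ne_zero_iff.2 ⟨i, rfl⟩).symm

lemma letterCount_eq_of_empirical_eq {x x' : Fin n → B} (h : empirical x = empirical x') :
    letterCount x = letterCount x' := by
  funext b
  rcases Nat.eq_zero_or_pos n with h0 | h0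
  · have h1 := letterCount_le x b
    have h2 := letterCount_le x' b
    omega
  · have := congrFun h b
    rw [empirical_apply, empirical_apply] at this
    have hn : (n : ℝ) ≠ 0 := by positivity
    exact_mod_cast (div_left_inj' hn).1 this

lemma empirical_comp_perm (x : Fin n → B) (g : Equiv.Perm (Fin n)) :
    empirical (x ∘ g) = empirical x := by
  classical
  funext b
  rw [empirical_apply, empirical_apply]
  congr 2
  unfold letterCount
  exact card_bij (fun i _ => g i) (by simp) (fun _ _ _ _ h => g.injective h)
    (fun i hi => ⟨g.symm i, by simpa using hi, by simp⟩)

lemma seqProb_nonneg {P : B → ℝ} (hP : ∀ b, 0 ≤ P b) (x : Fin n → B) : 0 ≤ seqProb P x :=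
  prod_nonneg fun _ _ => hP _

lemma seqProb_comp_perm (P : B → ℝ) (x : Fin n → B) (g : Equiv.Perm (Fin n)) :
    seqProb P (x ∘ g) = seqProb P x :=
  Equiv.prod_comp g fun i => P (x i)

/-- Type classes are permutation orbits: equal letter counts let the fibres of `x'` and `x` be
matched letter by letter. -/
lemma exists_perm_of_empirical_eq {x x' : Fin n → B} (h : empirical x = empirical x') :
    ∃ g : Equiv.Perm (Fin n), x' = x ∘ g := by
  classical
  have hc := letterCount_eq_of_empirical_eq h
  have e : ∀ b, {i // x' i = b} ≃ {i // x i = b} := fun b => by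
    refine Fintype.equivOfCardEq ?_
    have := congrFun hc b
    unfold letterCount at this
    rw [Fintype.card_subtype, Fintype.card_subtype]
    convert this.symm
  refine ⟨((Equiv.sigmaFiberEquiv x').symm.trans (Equiv.sigmaCongrRight e)).trans
    (Equiv.sigmaFiberEquiv x), ?_⟩
  funext i
  simp only [Function.comp_apply, Equiv.trans_apply]
  exact (e (x' i) ⟨i, rfl⟩).2.symm

variable [Fintype B]

lemma natCast_mul_sum_empirical (x : Fin n → B) (f : B → ℝ) :
    n * ∑ b, empirical x b * f b = ∑ i, f (x i) := by
  classical
  rcases Nat.eq_zero_or_pos n with rfl | hn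
  · simp
  · rw [mul_sum, ← sum_fiberwise (s := univ) x fun i => f (x i)]
    refine sum_congr rfl fun b _ => ?_
    have : ∑ i with x i = b, f (x i) = ∑ i with x i = b, f b :=
      sum_congr rfl fun i hi => by rw [(mem_filter.1 hi).2]
    rw [this, sum_const, nsmul_eq_mul, empirical_apply]
    have hn' : (n : ℝ) ≠ 0 := by positivity
    have e : letterCount x b = #{i | x i = b} := by
      unfold letterCount
      congr!
    rw [e]
    field_simp

lemma sum_letterCount (x : Fin n → B) : ∑ b, letterCount x b = n := by
  classical
  have h := card_eq_sum_card_fiberwise (f := x) (s := univ) (t := univ) (fun _ _ => by simp)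
  rw [Finset.card_univ, Fintype.card_fin] at h
  refine Eq.trans ?_ h.symm
  refine sum_congr rfl fun b _ => ?_
  unfold letterCount
  congr!

lemma empirical_mem_stdSimplex (hn : n ≠ 0) (x : Fin n → B) :
    empirical x ∈ stdSimplex ℝ B := by
  refine ⟨empirical_nonneg x, ?_⟩
  have := natCast_mul_sum_empirical x fun _ => 1
  have hn' : (n : ℝ) ≠ 0 := by exact_mod_cast hn
  simp only [mul_one, sum_const, card_univ, Fintype.card_fin, nsmul_eq_mul] at this
  exact mul_left_cancel₀ hn' (this.trans (mul_one _).symm)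

lemma empirical_comp (f : B → C) (x : Fin n → B) :
    empirical (fun i => f (x i)) = pushWeight f (empirical x) := by
  classical
  funext c
  rcases Nat.eq_zero_or_pos n with rfl | hn
  · simp [empirical, pushWeight]
  · have h := natCast_mul_sum_empirical x fun b => if f b = c then 1 else 0
    have hn' : (n : ℝ) ≠ 0 := by positivity
    refine mul_left_cancel₀ hn' ?_
    have e : pushWeight f (empirical x) c = ∑ b, empirical x b * if f b = c then 1 else 0 := by
      simp [pushWeight]
    rw [e, h, empirical_apply, mul_div_cancel₀ _ hn', letterCount]
    simp

lemma card_image_empirical_le [DecidableEq (B → ℝ)] :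
    (univ.image fun x : Fin n → B => empirical x).card ≤ (n + 1) ^ Fintype.card B := by
  classical
  have h : (univ.image fun x : Fin n → B => empirical x) ⊆
      univ.image fun k : B → Fin (n + 1) => fun b => ((k b : ℕ) : ℝ) / n := by
    intro t ht
    obtain ⟨x, -, rfl⟩ := mem_image.1 ht
    exact mem_image.2 ⟨fun b => ⟨letterCount x b, Nat.lt_succ_of_le (letterCount_le x b)⟩,
      mem_univ _, rfl⟩
  refine (card_le_card h).trans (card_image_le.trans_eq ?_)
  simp

lemma seqProb_eq_prod_pow (P : B → ℝ) (x : Fin n → B) :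
    seqProb P x = ∏ b, P b ^ letterCount x b := by
  classical
  unfold seqProb
  rw [← prod_fiberwise univ x fun i => P (x i)]
  refine prod_congr rfl fun b _ => ?_
  rw [prod_congr rfl fun i hi => by rw [(mem_filter.1 hi).2], prod_const]
  unfold letterCount
  congr!

lemma sum_seqProb {P : B → ℝ} (hP : P ∈ stdSimplex ℝ B) :
    ∑ x : Fin n → B, seqProb P x = 1 := by
  classical
  have := Fintype.sum_pow P n
  rw [hP.2, one_pow] at this
  exact this.symm

/-- Change of measure from `P` to the type of `x`; the log-likelihood ratio is exactly `n` times the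
divergence. -/
lemma seqProb_eq_exp {P : B → ℝ} (x : Fin n → B) (hP : ∀ i, 0 < P (x i)) :
    seqProb P x = seqProb (empirical x) x * Real.exp (-(n * klSum (empirical x) P)) := by
  unfold klSum seqProb
  rw [natCast_mul_sum_empirical x fun b => Real.log (empirical x b / P b), ← sum_neg_distrib,
    Real.exp_sum, ← prod_mul_distrib]
  refine prod_congr rfl fun i _ => ?_
  have h1 := empirical_pos x i
  have h2 := hP i
  rw [← Real.log_inv, Real.exp_log (by positivity)]
  field_simp

/-- The self-probabilities of sequences sum up to at most the number of types. -/
lemma sum_seqProb_empirical_le (hn : n ≠ 0) :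
    ∑ x : Fin n → B, seqProb (empirical x) x ≤ ((n : ℝ) + 1) ^ Fintype.card B := by
  classical
  calc ∑ x : Fin n → B, seqProb (empirical x) x
      = ∑ t ∈ univ.image fun x : Fin n → B => empirical x,
          ∑ x : Fin n → B with empirical x = t, seqProb (empirical x) x :=
        (sum_fiberwise_of_maps_to (fun x _ => mem_image_of_mem _ (mem_univ x)) _).symm
    -- Within one type class all self-probabilities come from the same memoryless source, whose
    -- total mass is one.
    _ ≤ ∑ t ∈ univ.image fun x : Fin n → B => empirical x, (1 : ℝ) := by
        refine sum_le_sum fun t ht => ?_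
        obtain ⟨z, -, rfl⟩ := mem_image.1 ht
        rw [← sum_seqProb (n := n) (empirical_mem_stdSimplex hn z)]
        rw [sum_congr rfl fun x hx => by rw [(mem_filter.1 hx).2]]
        exact sum_le_sum_of_subset_of_nonneg (filter_subset _ _)
          fun x _ _ => seqProb_nonneg (empirical_nonneg z) x
    _ ≤ _ := by
        rw [sum_const, nsmul_eq_mul, mul_one]
        exact_mod_cast card_image_empirical_le

-- A Stirling-type upper bound by induction on `k`, which reduces to `e ≤ (1 + 1/k)^(k+1)`.
open Nat in
lemma factorial_le_mul_exp {k : ℕ} (hk : 1 ≤ k) :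
    (k ! : ℝ) ≤ Real.exp 1 * k * ((k : ℝ) ^ k * Real.exp (-k)) := by
  induction k, hk using Nat.le_induction with
  | base => simp [← Real.exp_add]
  | succ k hk ih =>
    have hk0 : (0 : ℝ) < k := by exact_mod_cast hk
    have key : Real.exp 1 * (k : ℝ) ^ (k + 1) ≤ ((k : ℝ) + 1) ^ (k + 1) := by
      have h1 := Real.one_sub_inv_le_log_of_pos (x := ((k : ℝ) + 1) / k) (by positivity)
      have h2 : (1 : ℝ) ≤ (k + 1 : ℕ) * Real.log (((k : ℝ) + 1) / k) := by
        have := mul_le_mul_of_nonneg_left h1 (by positivity : (0 : ℝ) ≤ (k + 1 : ℕ))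
        refine le_trans (le_of_eq ?_) this
        push_cast
        field_simp
        ring
      have h3 := Real.exp_le_exp.2 h2
      rw [← Real.log_pow, Real.exp_log (by positivity), div_pow, le_div_iff₀ (by positivity)] at h3
      exact h3
    rw [Nat.factorial_succ]
    push_cast
    calc ((k : ℝ) + 1) * k ! ≤ (k + 1) * (Real.exp 1 * k * ((k : ℝ) ^ k * Real.exp (-k))) := by
          gcongr
      _ = (k + 1) * Real.exp (-k) * (Real.exp 1 * (k : ℝ) ^ (k + 1)) := by ring
      _ ≤ (k + 1) * Real.exp (-k) * ((k : ℝ) + 1) ^ (k + 1) := by gcongr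
      _ = _ := by
          have : Real.exp (-(k : ℝ)) = Real.exp 1 * Real.exp (-((k : ℝ) + 1)) := by
            rw [← Real.exp_add]
            congr 1
            ring
          rw [this]
          ring

open Nat in
lemma factorial_le_mul_exp_of_le {k n : ℕ} (hk : k ≤ n) :
    (k ! : ℝ) ≤ Real.exp 1 * (n + 1) * ((k : ℝ) ^ k * Real.exp (-k)) := by
  rcases Nat.eq_zero_or_pos k with rfl | h
  · have : (1 : ℝ) ≤ Real.exp 1 := Real.one_le_exp zero_le_one
    have hn : (0 : ℝ) ≤ n := by positivity
    simp
    nlinarith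
  · refine (factorial_le_mul_exp h).trans ?_
    have : (k : ℝ) ≤ n + 1 := by exact_mod_cast hk.trans (Nat.le_succ n)
    gcongr

/-- The sequences of the same type as `x`. -/
noncomputable def typeClass (x : Fin n → B) : Finset (Fin n → B) :=
  open Classical in univ.filter fun x' => empirical x' = empirical x

lemma mem_typeClass {x x' : Fin n → B} : x' ∈ typeClass x ↔ empirical x' = empirical x := by
  simp [typeClass]

-- Orbit counting: a nonempty fibre of `g ↦ x ∘ g` is a translate of the stabilizer of `x`, whose
-- order is the product of the factorials of the letter counts.
open Nat in
lemma factorial_le_card_typeClass_mul (x : Fin n → B) :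
    n ! ≤ (typeClass x).card * ∏ b, (letterCount x b)! := by
  classical
  have hmaps : ∀ g ∈ (univ : Finset (Equiv.Perm (Fin n))), x ∘ g ∈ typeClass x :=
    fun g _ => mem_typeClass.2 (empirical_comp_perm x g)
  have h := card_le_mul_card_image_of_maps_to (s := (univ : Finset (Equiv.Perm (Fin n))))
    (f := fun g : Equiv.Perm (Fin n) => x ∘ g) (t := typeClass x) hmaps (∏ b, (letterCount x b)!) ?_
  · rw [Finset.card_univ, Fintype.card_perm, Fintype.card_fin] at h
    rwa [mul_comm]
  · intro y _
    rcases (univ.filter fun g : Equiv.Perm (Fin n) => x ∘ g = y).eq_empty_or_nonempty with h0 | h0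
    · rw [h0]
      simp
    · obtain ⟨g₀, hg₀⟩ := h0
      have hg₀' : x ∘ g₀ = y := by simpa using hg₀
      have hst := DomMulAct.stabilizer_card (f := x)
      have hc : ∏ b, (letterCount x b)! = ∏ b, (Fintype.card {i // x i = b})! := by
        refine prod_congr rfl fun b _ => ?_
        rw [Fintype.card_subtype]
        unfold letterCount
        congr!
      rw [hc, ← hst, Fintype.card_subtype]
      refine card_le_card_of_injOn (fun g : Equiv.Perm (Fin n) => g * g₀⁻¹)
        (fun g hg => ?_) fun g _ g' _ h => ?_
      · have hg' : x ∘ g = y := by simpa using hg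
        have : x ∘ (g * g₀⁻¹ : Equiv.Perm (Fin n)) = x := by
          funext i
          have h1 := congrFun (hg'.trans hg₀'.symm) (g₀⁻¹ i)
          simpa using h1
        simpa using this
      · exact mul_right_cancel h

/-- A type class has at least inverse polynomial probability under its own type. Apply `n! ≥ nⁿ e⁻ⁿ`
and the upper bound on each `k!` to the orbit count; the exponentials cancel because the letter
counts sum to `n`. -/
lemma one_le_card_typeClass_mul (x : Fin n → B) :
    1 ≤ (Real.exp 1 * (n + 1)) ^ Fintype.card B * ((typeClass x).card * seqProb (empirical x) x) := by
  rcases Nat.eq_zero_or_pos n with rfl | hn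
  · have h1 : (typeClass x).card ≠ 0 := (card_pos.2 ⟨x, mem_typeClass.2 rfl⟩).ne'
    have h2 : (1 : ℝ) ≤ (typeClass x).card := by exact_mod_cast Nat.one_le_iff_ne_zero.2 h1
    have h3 : (1 : ℝ) ≤ (Real.exp 1) ^ Fintype.card B :=
      one_le_pow₀ (Real.one_le_exp zero_le_one)
    simp only [seqProb, univ_eq_empty, prod_empty, CharP.cast_eq_zero, zero_add, mul_one]
    nlinarith
  · have hn0 : (0 : ℝ) < n := by exact_mod_cast hn
    have h1 : (Nat.factorial n : ℝ) ≤
        (typeClass x).card * ∏ b, ((letterCount x b).factorial : ℝ) := by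
      exact_mod_cast factorial_le_card_typeClass_mul x
    have h2 : ∏ b, ((letterCount x b).factorial : ℝ) ≤ ∏ b, (Real.exp 1 * (n + 1) *
        ((letterCount x b : ℝ) ^ letterCount x b * Real.exp (-(letterCount x b : ℝ)))) :=
      prod_le_prod (fun _ _ => by positivity)
        fun b _ => factorial_le_mul_exp_of_le (letterCount_le x b)
    have h3 : ∏ b, Real.exp (-(letterCount x b : ℝ)) = Real.exp (-n) := by
      rw [← Real.exp_sum, sum_neg_distrib]
      congr 2
      exact_mod_cast sum_letterCount x
    have h4 : ∏ b, (letterCount x b : ℝ) ^ letterCount x b =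
        (n : ℝ) ^ n * seqProb (empirical x) x := by
      have hpow : (n : ℝ) ^ n = (n : ℝ) ^ ∑ b, letterCount x b := by rw [sum_letterCount]
      rw [seqProb_eq_prod_pow, hpow, ← prod_pow_eq_pow_sum, ← prod_mul_distrib]
      refine prod_congr rfl fun b _ => ?_
      rw [empirical_apply, div_pow]
      field_simp
    rw [prod_mul_distrib, prod_const, prod_mul_distrib, Finset.card_univ, h3, h4] at h2
    have h5 : (n : ℝ) ^ n ≤ Real.exp n * n.factorial := by
      have := Real.pow_div_factorial_le_exp (n : ℝ) hn0.le n
      rwa [div_le_iff₀ (by positivity)] at this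
    have h6 : (n : ℝ) ^ n * Real.exp (-n) ≤ n.factorial := by
      rw [Real.exp_neg, ← div_eq_mul_inv, div_le_iff₀ (Real.exp_pos _), mul_comm]
      exact h5
    have h7 := h6.trans (h1.trans (mul_le_mul_of_nonneg_left h2 (by positivity)))
    have h8 : (0 : ℝ) < (n : ℝ) ^ n * Real.exp (-n) := by positivity
    refine le_of_mul_le_mul_left ?_ h8
    rw [mul_one]
    refine h7.trans (le_of_eq ?_)
    ring

/-- Every probability vector is a limit of types of sequences with letters in its support. -/
lemma exists_tendsto_empirical {R : B → ℝ} (hR : R ∈ stdSimplex ℝ B) :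
    ∃ s : ∀ n : ℕ, Fin n → B, (∀ n i, R (s n i) ≠ 0) ∧
      Tendsto (fun n => empirical (s n)) atTop (𝓝 R) := by
  classical
  obtain ⟨b₀, hb₀⟩ : ∃ b, R b ≠ 0 := by
    by_contra! h
    have := hR.2
    simp [h] at this
  -- Round all counts down and give the remainder to a letter `b₀` of the support, so that letters
  -- of mass zero are never used.
  set k : ℕ → B → ℕ := fun n b => if b = b₀ then n - ∑ b ∈ univ.erase b₀, ⌊R b * n⌋₊
    else ⌊R b * n⌋₊ with hk
  have hle : ∀ n : ℕ, ∑ b ∈ univ.erase b₀, ⌊R b * n⌋₊ ≤ n := fun n => by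
    have h1 : ∑ b ∈ univ.erase b₀, (⌊R b * n⌋₊ : ℝ) ≤ ∑ b ∈ univ.erase b₀, R b * n :=
      sum_le_sum fun b _ => Nat.floor_le (mul_nonneg (hR.1 b) (by positivity))
    have h2 : ∑ b ∈ univ.erase b₀, R b * n ≤ ∑ b, R b * n :=
      sum_le_sum_of_subset_of_nonneg (erase_subset _ _)
        fun b _ _ => mul_nonneg (hR.1 b) (by positivity)
    rw [← sum_mul univ, hR.2, one_mul] at h2
    exact_mod_cast h1.trans h2
  have hsum : ∀ n, ∑ b, k n b = n := fun n => by
    rw [← add_sum_erase _ _ (mem_univ b₀)]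
    have : ∑ b ∈ univ.erase b₀, k n b = ∑ b ∈ univ.erase b₀, ⌊R b * n⌋₊ :=
      sum_congr rfl fun b hb => by simp [hk, ne_of_mem_erase hb]
    rw [this]
    simp only [hk, if_true]
    exact Nat.sub_add_cancel (hle n)
  have e : ∀ n, Fin n ≃ Σ b, Fin (k n b) := fun n => Fintype.equivOfCardEq (by simp [hsum])
  have hcount : ∀ n b, letterCount (fun i => (e n i).1) b = k n b := by
    intro n b
    rw [letterCount, ← Fintype.card_subtype]
    refine (Fintype.card_congr ((e n).subtypeEquiv
      (q := fun z => z.1 = b) fun i => Iff.rfl)).trans ?_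
    rw [Fintype.card_congr (Equiv.sigmaSubtype b)]
    simp
  refine ⟨fun n i => (e n i).1, fun n i => ?_, ?_⟩
  · have h : 0 < k n ((e n i).1) := by
      rw [← hcount n]
      exact letterCount_pos_iff.2 ⟨i, rfl⟩
    intro h0
    have hne : (e n i).1 ≠ b₀ := fun h1 => hb₀ (h1 ▸ h0)
    simp [hk, hne, h0] at h
  · have hother : ∀ b, b ≠ b₀ → Tendsto (fun n : ℕ => (k n b : ℝ) / n) atTop (𝓝 (R b)) := by
      intro b hb
      simp only [hk, hb, if_false]
      exact (tendsto_nat_floor_mul_div_atTop (hR.1 b)).comp tendsto_natCast_atTop_atTop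
    rw [tendsto_pi_nhds]
    intro b
    simp only [empirical_apply, hcount]
    by_cases hb : b = b₀
    · subst hb
      have h1 : Tendsto (fun n : ℕ => 1 - ∑ c ∈ univ.erase b, (k n c : ℝ) / n) atTop
          (𝓝 (1 - ∑ c ∈ univ.erase b, R c)) :=
        tendsto_const_nhds.sub (tendsto_finsetSum _ fun c hc => hother c (ne_of_mem_erase hc))
      have h2 : 1 - ∑ c ∈ univ.erase b, R c = R b := by
        rw [← hR.2, ← add_sum_erase _ _ (mem_univ b)]
        ring
      rw [h2] at h1
      refine h1.congr' ?_
      filter_upwards [eventually_gt_atTop 0] with n hn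
      have hn' : (n : ℝ) ≠ 0 := by positivity
      have h3 : (k n b : ℝ) + ∑ c ∈ univ.erase b, (k n c : ℝ) = n := by
        exact_mod_cast (add_sum_erase _ _ (mem_univ b)).trans (hsum n)
      rw [← sum_div]
      field_simp
      linarith
    · exact hother b hb

end Types

/-! ### Couplings and their regularization. -/

section Joint

variable {A : Type*}

lemma exists_letter_min {d : A → A → ℝ} {Δ₀ Δ₁ : ℝ}
    (hΔ₀ : ∀ a, ∃ b, d a b ≤ Δ₀) (hΔ₁ : ∀ a, ∃ b, d a b ≤ Δ₁) (a : A) :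
    ∃ b, d a b ≤ Δ₀ ∧ d a b ≤ Δ₁ := by
  rcases le_total Δ₀ Δ₁ with h | h
  · obtain ⟨b, hb⟩ := hΔ₀ a
    exact ⟨b, hb, hb.trans h⟩
  · obtain ⟨b, hb⟩ := hΔ₁ a
    exact ⟨b, hb.trans h, hb⟩

variable [Fintype A]

lemma pushWeight_pushWeight {B C D : Type*} [Fintype B] [Fintype C] (f : B → C) (g : C → D)
    (R : B → ℝ) : pushWeight g (pushWeight f R) = pushWeight (fun b => g (f b)) R := by
  classical
  funext e
  have h := sum_pushWeight f R fun c => if g c = e then 1 else 0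
  simpa [pushWeight] using h

lemma pushWeight_id (R : A → ℝ) : pushWeight (fun a => a) R = R := by
  classical
  funext a
  simp [pushWeight]

lemma sum_mix_mul {B : Type*} [Fintype B] (R R' c : B → ℝ) (t : ℝ) :
    ∑ b, ((1 - t) • R + t • R') b * c b = (1 - t) * ∑ b, R b * c b + t * ∑ b, R' b * c b := by
  rw [mul_sum, mul_sum, ← sum_add_distrib]
  refine sum_congr rfl fun b _ => ?_
  simp only [Pi.add_apply, Pi.smul_apply, smul_eq_mul]
  ring

lemma mix_mem_stdSimplex {B : Type*} [Fintype B] {R R' : B → ℝ} (hR : R ∈ stdSimplex ℝ B)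
    (hR' : R' ∈ stdSimplex ℝ B) {t : ℝ} (ht : 0 ≤ t) (ht' : t ≤ 1) :
    (1 - t) • R + t • R' ∈ stdSimplex ℝ B :=
  convex_stdSimplex ℝ B hR hR' (sub_nonneg.2 ht') ht (by ring)

/-- Excess distortion of the first coordinate with respect to the last one. -/
def excess₀ (d : A → A → ℝ) (Δ : ℝ) (b : A × A × A) : ℝ := d b.1 b.2.2 - Δ

/-- Excess distortion of the second coordinate with respect to the last one. -/
def excess₁ (d : A → A → ℝ) (Δ : ℝ) (b : A × A × A) : ℝ := d b.2.1 b.2.2 - Δ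

/-- Joint laws of `(X₀, X₁, Y)` with `E d(Xᵢ, Y) ≤ Δᵢ` and `Xᵢ` supported in the support of `Pᵢ`. -/
def couplings (d : A → A → ℝ) (Δ₀ Δ₁ : ℝ) (P₀ P₁ : A → ℝ) : Set (A × A × A → ℝ) :=
  {R | R ∈ stdSimplex ℝ (A × A × A) ∧ (∀ b, P₀ b.1 = 0 → R b = 0) ∧
    (∀ b, P₁ b.2.1 = 0 → R b = 0) ∧ ∑ b, R b * excess₀ d Δ₀ b ≤ 0 ∧
    ∑ b, R b * excess₁ d Δ₁ b ≤ 0}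

/-- The law of `X₀`. -/
noncomputable def law₀ (R : A × A × A → ℝ) : A → ℝ := pushWeight (fun b => b.1) R

/-- The law of `X₁`. -/
noncomputable def law₁ (R : A × A × A → ℝ) : A → ℝ := pushWeight (fun b => b.2.1) R

variable {d : A → A → ℝ} {Δ₀ Δ₁ : ℝ} {P₀ P₁ : A → ℝ}

lemma mix_mem_couplings {R R' : A × A × A → ℝ} (hR : R ∈ couplings d Δ₀ Δ₁ P₀ P₁)
    (hR' : R' ∈ couplings d Δ₀ Δ₁ P₀ P₁) {t : ℝ} (ht : 0 ≤ t) (ht' : t ≤ 1) :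
    (1 - t) • R + t • R' ∈ couplings d Δ₀ Δ₁ P₀ P₁ := by
  obtain ⟨h1, h2, h3, h4, h5⟩ := hR
  obtain ⟨h1', h2', h3', h4', h5'⟩ := hR'
  have ht1 : 0 ≤ 1 - t := sub_nonneg.2 ht'
  refine ⟨mix_mem_stdSimplex h1 h1' ht ht', fun b hb => ?_, fun b hb => ?_, ?_, ?_⟩
  · simp [h2 b hb, h2' b hb]
  · simp [h3 b hb, h3' b hb]
  · rw [sum_mix_mul]
    nlinarith
  · rw [sum_mix_mul]
    nlinarith

lemma isCompact_couplings : IsCompact (couplings d Δ₀ Δ₁ P₀ P₁) := by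
  have h : couplings d Δ₀ Δ₁ P₀ P₁ = stdSimplex ℝ (A × A × A) ∩
      ({R | ∀ b : A × A × A, P₀ b.1 = 0 → R b = 0} ∩ ({R | ∀ b : A × A × A, P₁ b.2.1 = 0 → R b = 0} ∩
      ({R | ∑ b, R b * excess₀ d Δ₀ b ≤ 0} ∩ {R | ∑ b, R b * excess₁ d Δ₁ b ≤ 0}))) := rfl
  rw [h]
  refine (isCompact_stdSimplex ℝ _).inter_right (IsClosed.inter ?_ (IsClosed.inter ?_
    (IsClosed.inter (isClosed_le (by fun_prop) continuous_const)
      (isClosed_le (by fun_prop) continuous_const))))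
  all_goals
    simp only [Set.ofPred_forall]
    exact isClosed_iInter fun b => isClosed_iInter fun _ =>
      isClosed_eq (continuous_apply b) continuous_const

lemma single_mem_couplings [DecidableEq A] {b : A × A × A} (h0 : P₀ b.1 ≠ 0) (h1 : P₁ b.2.1 ≠ 0)
    (e0 : excess₀ d Δ₀ b ≤ 0) (e1 : excess₁ d Δ₁ b ≤ 0) :
    Pi.single b 1 ∈ couplings d Δ₀ Δ₁ P₀ P₁ := by
  refine ⟨single_mem_stdSimplex ℝ b, fun c hc => ?_, fun c hc => ?_, ?_, ?_⟩
  · exact Pi.single_eq_of_ne (by rintro rfl; exact h0 hc) _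
  · exact Pi.single_eq_of_ne (by rintro rfl; exact h1 hc) _
  · simpa [Pi.single_apply] using e0
  · simpa [Pi.single_apply] using e1

lemma law₀_mix (R R' : A × A × A → ℝ) (t : ℝ) :
    law₀ ((1 - t) • R + t • R') = (1 - t) • law₀ R + t • law₀ R' := pushWeight_mix _ _ _ _

lemma continuous_klSum_law₀ : Continuous fun R : A × A × A → ℝ => klSum (law₀ R) P₀ :=
  (continuous_klSum P₀).comp (continuous_pushWeight _)

lemma continuous_klSum_law₁ : Continuous fun R : A × A × A → ℝ => klSum (law₁ R) P₁ :=
  (continuous_klSum P₁).comp (continuous_pushWeight _)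

lemma law₀_ac {R : A × A × A → ℝ} (hR : R ∈ couplings d Δ₀ Δ₁ P₀ P₁) :
    ∀ a, P₀ a = 0 → law₀ R a = 0 := fun a ha =>
  pushWeight_eq_zero _ fun b hb => hR.2.1 b (by rw [hb, ha])

lemma law₁_ac {R : A × A × A → ℝ} (hR : R ∈ couplings d Δ₀ Δ₁ P₀ P₁) :
    ∀ a, P₁ a = 0 → law₁ R a = 0 := fun a ha =>
  pushWeight_eq_zero _ fun b hb => hR.2.2.1 b (by rw [hb, ha])

/-- The coupling in which `X₀ = X₁` has law `P₀` and is moved by a common admissible map. -/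
lemma exists_coupling_law₀_eq (hP₀ : P₀ ∈ stdSimplex ℝ A) (hac : ∀ a, P₁ a = 0 → P₀ a = 0)
    (hΔ₀ : ∀ a, ∃ b, d a b ≤ Δ₀) (hΔ₁ : ∀ a, ∃ b, d a b ≤ Δ₁) :
    ∃ R ∈ couplings d Δ₀ Δ₁ P₀ P₁, law₀ R = P₀ := by
  choose β hβ₀ hβ₁ using exists_letter_min hΔ₀ hΔ₁
  have hpush : ∀ c : A × A × A, (P₀ c.1 = 0 ∨ P₀ c.2.1 = 0) →
      pushWeight (fun a => (a, a, β a)) P₀ c = 0 := fun c hc =>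
    pushWeight_eq_zero _ fun a ha => by
      subst ha
      simpa using hc
  refine ⟨pushWeight (fun a => (a, a, β a)) P₀, ⟨pushWeight_mem_stdSimplex _ hP₀,
    fun c hc => hpush c (Or.inl hc), fun c hc => hpush c (Or.inr (hac _ hc)), ?_, ?_⟩, ?_⟩
  · rw [sum_pushWeight]
    exact sum_nonpos fun a _ => mul_nonpos_of_nonneg_of_nonpos (hP₀.1 a) (sub_nonpos.2 (hβ₀ a))
  · rw [sum_pushWeight]
    exact sum_nonpos fun a _ => mul_nonpos_of_nonneg_of_nonpos (hP₀.1 a) (sub_nonpos.2 (hβ₁ a))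
  · rw [law₀, pushWeight_pushWeight]
    exact pushWeight_id P₀

/-- If `c` is nonnegative on the support of `R` and has nonpositive mean, it vanishes there. -/
lemma eq_zero_of_sum_mul_nonpos {B : Type*} [Fintype B] {R c : B → ℝ} (hR : ∀ b, 0 ≤ R b)
    (hc : ∀ b, R b ≠ 0 → 0 ≤ c b) (h : ∑ b, R b * c b ≤ 0) (b : B) (hb : R b ≠ 0) : c b = 0 := by
  have hnn : ∀ b ∈ univ, 0 ≤ R b * c b := fun b _ => by
    by_cases h0 : R b = 0
    · simp [h0]
    · exact mul_nonneg (hR b) (hc b h0)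
  have := (sum_eq_zero_iff_of_nonneg hnn).1 (le_antisymm h (sum_nonneg hnn)) b (mem_univ b)
  exact (mul_eq_zero.1 this).resolve_left hb

/-- A pair with `d x y < Δ₀` and `d x y ≤ Δ₁` gives a slack point mass at `(x, x, y)`. Without such
a pair, admissibility forces `Δ₀ ≤ Δ₁`, so `d ≥ Δ₀` from the support of `P₀`, and a nonpositive mean
excess must vanish pointwise. -/
lemma slack₀_or_tight (hP₀ : P₀ ∈ stdSimplex ℝ A) (hac : ∀ a, P₁ a = 0 → P₀ a = 0)
    (hΔ₁ : ∀ a, ∃ b, d a b ≤ Δ₁) :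
    (∃ R ∈ couplings d Δ₀ Δ₁ P₀ P₁, ∑ b, R b * excess₀ d Δ₀ b < 0) ∨
      ∀ R ∈ couplings d Δ₀ Δ₁ P₀ P₁, ∀ b, R b ≠ 0 → excess₀ d Δ₀ b = 0 := by
  classical
  by_cases hex : ∃ x y, P₀ x ≠ 0 ∧ d x y < Δ₀ ∧ d x y ≤ Δ₁
  · left
    obtain ⟨x, y, hx, h0, h1⟩ := hex
    refine ⟨Pi.single (x, x, y) 1, single_mem_couplings hx (fun h => hx (hac _ h))
      (sub_nonpos.2 h0.le) (sub_nonpos.2 h1), ?_⟩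
    simpa [Pi.single_apply, excess₀] using h0
  · right
    push Not at hex
    obtain ⟨a, ha⟩ : ∃ a, P₀ a ≠ 0 := by
      by_contra! h
      have := hP₀.2
      simp [h] at this
    have hle : Δ₀ ≤ Δ₁ := by
      by_contra! h
      obtain ⟨b, hb⟩ := hΔ₁ a
      exact absurd hb (hex a b ha (hb.trans_lt h)).not_ge
    intro R hR
    refine eq_zero_of_sum_mul_nonpos hR.1.1 (fun b hb => ?_) hR.2.2.2.1
    have hb0 : P₀ b.1 ≠ 0 := fun h => hb (hR.2.1 b h)
    by_contra! h
    have h' : d b.1 b.2.2 < Δ₀ := sub_neg.1 h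
    exact absurd (h'.le.trans hle) (hex _ _ hb0 h').not_ge

/-- Not symmetric to the previous case, since `P₁` may charge letters that `P₀` does not, so `X₀ =
X₁` is not always available. If no point mass is slack, the order of `Δ₀` and `Δ₁` decides. -/
lemma slack₁_or_tight (hP₀ : P₀ ∈ stdSimplex ℝ A) (hac : ∀ a, P₁ a = 0 → P₀ a = 0)
    (hΔ₀ : ∀ a, ∃ b, d a b ≤ Δ₀) (hΔ₁ : ∀ a, ∃ b, d a b ≤ Δ₁) :
    (∃ R ∈ couplings d Δ₀ Δ₁ P₀ P₁, ∑ b, R b * excess₁ d Δ₁ b < 0) ∨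
      ∀ R ∈ couplings d Δ₀ Δ₁ P₀ P₁, ∀ b, R b ≠ 0 → excess₁ d Δ₁ b = 0 := by
  classical
  obtain ⟨a, ha⟩ : ∃ a, P₀ a ≠ 0 := by
    by_contra! h
    have := hP₀.2
    simp [h] at this
  by_cases hex : ∃ b : A × A × A, P₀ b.1 ≠ 0 ∧ P₁ b.2.1 ≠ 0 ∧ excess₀ d Δ₀ b ≤ 0 ∧
      excess₁ d Δ₁ b < 0
  · left
    obtain ⟨b, h0, h1, e0, e1⟩ := hex
    refine ⟨Pi.single b 1, single_mem_couplings h0 h1 e0 e1.le, ?_⟩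
    simpa [Pi.single_apply] using e1
  push Not at hex
  rcases lt_trichotomy Δ₀ Δ₁ with hlt | heq | hgt
  · obtain ⟨y, hy⟩ := hΔ₀ a
    exact absurd (sub_nonneg.1 (hex (a, a, y) ha (fun h => ha (hac _ h)) (sub_nonpos.2 hy)))
      (hy.trans_lt hlt).not_ge
  -- For `Δ₀ = Δ₁` the two excesses agree on the diagonal `X₀ = X₁`; this makes the first constraint
  -- tight, and then the second.
  · right
    intro R hR
    have h0 : ∀ b, R b ≠ 0 → excess₀ d Δ₀ b = 0 := by
      refine eq_zero_of_sum_mul_nonpos hR.1.1 (fun b hb => ?_) hR.2.2.2.1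
      have hb0 : P₀ b.1 ≠ 0 := fun h => hb (hR.2.1 b h)
      by_contra! h
      have := hex (b.1, b.1, b.2.2) hb0 (fun h => hb0 (hac _ h)) h.le
      simp only [excess₀, excess₁] at h this
      linarith
    refine eq_zero_of_sum_mul_nonpos hR.1.1 (fun b hb => ?_) hR.2.2.2.2
    exact hex b (fun h => hb (hR.2.1 b h)) (fun h => hb (hR.2.2.1 b h)) (h0 b hb).le
  · by_cases hx : ∃ x y, P₁ x ≠ 0 ∧ d x y < Δ₁
    · left
      obtain ⟨x, y, hx1, hxy⟩ := hx
      obtain ⟨β, hβ⟩ := hΔ₁ a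
      set γ := Δ₀ - Δ₁ with hγ
      have hγ0 : 0 < γ := sub_pos.2 hgt
      set C := |excess₀ d Δ₀ (a, x, y)| with hC
      have hC0 : 0 ≤ C := abs_nonneg _
      -- The point `(a, x, y)` may exceed `Δ₀` by at most `C`, while `(a, a, β)` has room `γ`. This
      -- weight solves `s * C = (1 - s) * γ`, so the mixture stays admissible.
      set s := γ / (γ + C) with hs
      have hs0 : 0 < s := by positivity
      have hs1 : s ≤ 1 := (div_le_one (by positivity)).2 (by linarith)
      have hsC : s * C ≤ (1 - s) * γ := by
        have : s * (γ + C) = γ := div_mul_cancel₀ _ (by positivity)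
        nlinarith
      have e0 : excess₀ d Δ₀ (a, x, y) ≤ C := le_abs_self _
      have e0' : excess₀ d Δ₀ (a, a, β) ≤ -γ := by
        simp only [excess₀, hγ]
        linarith
      have e1 : excess₁ d Δ₁ (a, x, y) < 0 := sub_neg.2 hxy
      have e1' : excess₁ d Δ₁ (a, a, β) ≤ 0 := sub_nonpos.2 hβ
      have ha1 : P₁ a ≠ 0 := fun h => ha (hac _ h)
      set R : A × A × A → ℝ := (1 - s) • Pi.single (a, a, β) 1 + s • Pi.single (a, x, y) 1 with hR
      have hz : ∀ c : A × A × A, c ≠ (a, a, β) → c ≠ (a, x, y) → R c = 0 := fun c h1 h2 => by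
        simp [hR, h1, h2]
      have hsum : ∀ c : A × A × A → ℝ, ∑ b, R b * c b = (1 - s) * c (a, a, β) + s * c (a, x, y) :=
        fun c => by
          rw [hR, sum_mix_mul]
          simp [Pi.single_apply]
      have hneg : ∑ b, R b * excess₁ d Δ₁ b < 0 := by
        rw [hsum]
        nlinarith
      refine ⟨R, ⟨mix_mem_stdSimplex (single_mem_stdSimplex ℝ _) (single_mem_stdSimplex ℝ _)
        hs0.le hs1, fun c hc => hz c ?_ ?_, fun c hc => hz c ?_ ?_, ?_, hneg.le⟩, hneg⟩
      · rintro rfl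
        exact ha hc
      · rintro rfl
        exact ha hc
      · rintro rfl
        exact ha1 hc
      · rintro rfl
        exact hx1 hc
      · rw [hsum]
        nlinarith
    · right
      push Not at hx
      intro R hR
      refine eq_zero_of_sum_mul_nonpos hR.1.1 (fun b hb => ?_) hR.2.2.2.2
      exact sub_nonneg.2 (hx _ _ fun h => hb (hR.2.2.1 b h))

/-- Each distortion constraint is strict for `R`, or reads as a support constraint. -/
def StrictOrTight (c : A × A × A → ℝ) (R : A × A × A → ℝ) : Prop :=
  ∑ b, R b * c b < 0 ∨ ∀ b, R b ≠ 0 → c b = 0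

lemma StrictOrTight.mix {c R R' : A × A × A → ℝ} (hR : ∑ b, R b * c b ≤ 0) {t : ℝ} (ht : 0 < t)
    (ht' : t ≤ 1) (htight : ∑ b, R' b * c b < 0 ∨ ∀ b, ((1 - t) • R + t • R') b ≠ 0 → c b = 0) :
    StrictOrTight c ((1 - t) • R + t • R') := by
  refine htight.imp (fun h => ?_) id
  rw [sum_mix_mul]
  nlinarith

/-- A coupling of small divergence mixing with which makes all constraints strict or tight. -/
lemma exists_regularizer (hP₀ : P₀ ∈ stdSimplex ℝ A) (hac : ∀ a, P₁ a = 0 → P₀ a = 0)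
    (hΔ₀ : ∀ a, ∃ b, d a b ≤ Δ₀) (hΔ₁ : ∀ a, ∃ b, d a b ≤ Δ₁) {lam : ℝ} (hlam : 0 < lam) :
    ∃ M ∈ couplings d Δ₀ Δ₁ P₀ P₁, klSum (law₀ M) P₀ < lam ∧
      (∑ b, M b * excess₀ d Δ₀ b < 0 ∨
        ∀ R ∈ couplings d Δ₀ Δ₁ P₀ P₁, ∀ b, R b ≠ 0 → excess₀ d Δ₀ b = 0) ∧
      (∑ b, M b * excess₁ d Δ₁ b < 0 ∨
        ∀ R ∈ couplings d Δ₀ Δ₁ P₀ P₁, ∀ b, R b ≠ 0 → excess₁ d Δ₁ b = 0) := by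
  obtain ⟨R, hR, hR0⟩ := exists_coupling_law₀_eq hP₀ hac hΔ₀ hΔ₁
  have key : ∀ c : A × A × A → ℝ,
      ((∃ R ∈ couplings d Δ₀ Δ₁ P₀ P₁, ∑ b, R b * c b < 0) ∨
        ∀ R ∈ couplings d Δ₀ Δ₁ P₀ P₁, ∀ b, R b ≠ 0 → c b = 0) →
      ∃ N ∈ couplings d Δ₀ Δ₁ P₀ P₁, ∑ b, N b * c b < 0 ∨
        ∀ R ∈ couplings d Δ₀ Δ₁ P₀ P₁, ∀ b, R b ≠ 0 → c b = 0 := by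
    rintro c (⟨N, hN, h⟩ | h)
    · exact ⟨N, hN, Or.inl h⟩
    · exact ⟨R, hR, Or.inr h⟩
  obtain ⟨N, hN, hN'⟩ := key _ (slack₀_or_tight (d := d) (Δ₀ := Δ₀) hP₀ hac hΔ₁)
  obtain ⟨L, hL, hL'⟩ := key _ (slack₁_or_tight hP₀ hac hΔ₀ hΔ₁)
  -- `Q` inherits the slack of both `N` and `L`. A small share of it added to `R`, whose divergence
  -- is zero, keeps the slack and stays below `lam`.
  set Q := (1 - (1 / 2 : ℝ)) • N + (1 / 2 : ℝ) • L with hQ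
  have hQK : Q ∈ couplings d Δ₀ Δ₁ P₀ P₁ := mix_mem_couplings hN hL (by norm_num) (by norm_num)
  have hcont : Continuous fun t : ℝ => klSum (law₀ ((1 - t) • R + t • Q)) P₀ :=
    continuous_klSum_law₀.comp (by fun_prop)
  have h0 : klSum (law₀ ((1 - (0 : ℝ)) • R + (0 : ℝ) • Q)) P₀ < lam := by
    simpa [hR0, klSum_self] using hlam
  have hev := (hcont.tendsto 0).eventually_lt_const h0
  obtain ⟨t, htl, ht0, ht1⟩ := ((hev.filter_mono nhdsWithin_le_nhds).and
    (Ioo_mem_nhdsGT (zero_lt_one' ℝ))).exists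
  have hRx0 := hR.2.2.2.1
  have hRx1 := hR.2.2.2.2
  have hN1 := hN.2.2.2.2
  have hL0 := hL.2.2.2.1
  refine ⟨_, mix_mem_couplings hR hQK ht0.le ht1.le, htl, hN'.imp_left fun h => ?_,
    hL'.imp_left fun h => ?_⟩
  · rw [sum_mix_mul, hQ, sum_mix_mul]
    nlinarith
  · rw [sum_mix_mul, hQ, sum_mix_mul]
    nlinarith

/-- A coupling minimizing the divergence of `X₁` among those of divergence at most `lam` for
`X₀`. -/
lemma exists_optimal_coupling (hP₀ : P₀ ∈ stdSimplex ℝ A) (hac : ∀ a, P₁ a = 0 → P₀ a = 0)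
    (hΔ₀ : ∀ a, ∃ b, d a b ≤ Δ₀) (hΔ₁ : ∀ a, ∃ b, d a b ≤ Δ₁) {lam : ℝ} (hlam : 0 < lam) :
    ∃ R ∈ couplings d Δ₀ Δ₁ P₀ P₁, klSum (law₀ R) P₀ ≤ lam ∧
      ∀ R' ∈ couplings d Δ₀ Δ₁ P₀ P₁, klSum (law₀ R') P₀ ≤ lam →
        klSum (law₁ R) P₁ ≤ klSum (law₁ R') P₁ := by
  obtain ⟨R₀, hR₀, h0⟩ := exists_coupling_law₀_eq hP₀ hac hΔ₀ hΔ₁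
  have hcomp : IsCompact (couplings d Δ₀ Δ₁ P₀ P₁ ∩ {R | klSum (law₀ R) P₀ ≤ lam}) :=
    isCompact_couplings.inter_right (isClosed_le continuous_klSum_law₀ continuous_const)
  obtain ⟨R, hR, hmin⟩ := hcomp.exists_isMinOn
    ⟨R₀, hR₀, by simpa [h0, klSum_self] using hlam.le⟩
    (continuous_klSum_law₁ (P₁ := P₁)).continuousOn
  exact ⟨R, hR.1, hR.2, fun R' h h' => hmin ⟨h, h'⟩⟩

/-- Couplings which can be approximated by types, nearly as good as a given one. -/
lemma exists_regular_coupling (hP₀ : P₀ ∈ stdSimplex ℝ A) (hac : ∀ a, P₁ a = 0 → P₀ a = 0)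
    (hΔ₀ : ∀ a, ∃ b, d a b ≤ Δ₀) (hΔ₁ : ∀ a, ∃ b, d a b ≤ Δ₁) {lam : ℝ} (hlam : 0 < lam)
    {R : A × A × A → ℝ} (hR : R ∈ couplings d Δ₀ Δ₁ P₀ P₁) (hRl : klSum (law₀ R) P₀ ≤ lam)
    {r : ℝ} (hr : klSum (law₁ R) P₁ < r) :
    ∃ Q ∈ couplings d Δ₀ Δ₁ P₀ P₁, klSum (law₀ Q) P₀ < lam ∧ klSum (law₁ Q) P₁ < r ∧
      StrictOrTight (excess₀ d Δ₀) Q ∧ StrictOrTight (excess₁ d Δ₁) Q := by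
  obtain ⟨M, hM, hMl, hM0, hM1⟩ := exists_regularizer hP₀ hac hΔ₀ hΔ₁ hlam
  have hcont : Continuous fun t : ℝ => klSum (law₁ ((1 - t) • R + t • M)) P₁ :=
    continuous_klSum_law₁.comp (by fun_prop)
  have h0 : klSum (law₁ ((1 - (0 : ℝ)) • R + (0 : ℝ) • M)) P₁ < r := by simpa using hr
  have hev := (hcont.tendsto 0).eventually_lt_const h0
  obtain ⟨t, htl, ht0, ht1⟩ := ((hev.filter_mono nhdsWithin_le_nhds).and
    (Ioo_mem_nhdsGT (zero_lt_one' ℝ))).exists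
  have hmem := mix_mem_couplings hR hM ht0.le ht1.le
  refine ⟨_, hmem, ?_, htl, StrictOrTight.mix hR.2.2.2.1 ht0 ht1.le
    (hM0.imp_right fun h => h _ hmem), StrictOrTight.mix hR.2.2.2.2 ht0 ht1.le
    (hM1.imp_right fun h => h _ hmem)⟩
  -- Strictness below `lam` comes from convexity, as `R` may sit on the boundary while `M` is
  -- strictly inside; for `law₁`, continuity at `t = 0` was enough.
  rw [law₀_mix]
  refine (klSum_mix_le (pushWeight_mem_stdSimplex _ hR.1).1 (pushWeight_mem_stdSimplex _ hM.1).1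
    hP₀.1 ht0.le ht1.le).trans_lt ?_
  change (1 - t) * klSum (law₀ R) P₀ + t * klSum (law₀ M) P₀ < lam
  nlinarith

end Joint

/-! ### From couplings to the min-min problem over laws of `Y`. -/

section SingleLetter

variable {A : Type*} [Fintype A]

/-- Every joint law yields a channel from its second coordinate to the first one. -/
lemma tildeD_le_divergence {d : A → A → ℝ} {Δ : ℝ} {q : A × A → ℝ} (hq : q ∈ stdSimplex ℝ (A × A))
    (hd : ∑ b, q b * (d b.1 b.2 - Δ) ≤ 0) (P : A → ℝ) :
    tildeD d Δ (pushWeight (fun b => b.2) q) P ≤ divergence (pushWeight (fun b => b.1) q) P := by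
  classical
  set PY := pushWeight (fun b : A × A => b.2) q with hPY
  have hY : ∀ y, PY y = ∑ x, q (x, y) := fun y => by
    simp [hPY, pushWeight, Fintype.sum_prod_type]
  have hX : ∀ x, pushWeight (fun b : A × A => b.1) q x = ∑ y, q (x, y) := fun x => by
    simp only [pushWeight, Fintype.sum_prod_type]
    rw [sum_eq_single x (fun z _ hz => by simp [hz]) (by simp)]
    simp
  obtain ⟨a₀⟩ : Nonempty A := by
    by_contra h
    rw [not_nonempty_iff] at h
    have := hq.2
    simp at this
  -- The conditional law of `X` given `Y = y`. Rows of probability zero are irrelevant but must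
  -- still be probability vectors.
  set W : A → A → ℝ := fun y x => if PY y = 0 then (Pi.single a₀ 1 : A → ℝ) x else q (x, y) / PY y with hW
  have hW' : ∀ y x, PY y * W y x = q (x, y) := fun y x => by
    by_cases h : PY y = 0
    · have h0 : ∑ x, q (x, y) = 0 := (hY y).symm.trans h
      rw [h, zero_mul]
      exact ((sum_eq_zero_iff_of_nonneg fun x _ => hq.1 (x, y)).1 h0 x (mem_univ x)).symm
    · simp only [hW, if_neg h]
      field_simp
  have hPYs : PY ∈ stdSimplex ℝ A := pushWeight_mem_stdSimplex _ hq
  have hfeas : W ∈ feasibleChannels d Δ PY := by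
    refine ⟨fun y => ?_, ?_⟩
    · by_cases h : PY y = 0
      · have : W y = Pi.single a₀ 1 := by
          funext x
          simp [hW, h]
        rw [this]
        exact single_mem_stdSimplex ℝ a₀
      · have : W y = fun x => q (x, y) / PY y := by
          funext x
          simp [hW, h]
        rw [this]
        refine ⟨fun x => div_nonneg (hq.1 _) (hPYs.1 y), ?_⟩
        rw [← sum_div, ← hY, div_self h]
    · simp only [hW']
      have h2 := hq.2
      simp only [mul_sub, sum_sub_distrib, ← sum_mul, h2, one_mul, Fintype.sum_prod_type] at hd
      linarith
  have hout : outputLaw PY W = pushWeight (fun b : A × A => b.1) q := by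
    funext x
    simp only [outputLaw, hW', hX]
  rw [← hout]
  exact iInf₂_le W hfeas

variable {d : A → A → ℝ} {Δ₀ Δ₁ : ℝ} {P₀ P₁ : A → ℝ}

lemma tildeD_le_law₀ {R : A × A × A → ℝ} (hR : R ∈ couplings d Δ₀ Δ₁ P₀ P₁) :
    tildeD d Δ₀ (pushWeight (fun b => b.2.2) R) P₀ ≤ (klSum (law₀ R) P₀ : EReal) := by
  have h := tildeD_le_divergence (d := d) (Δ := Δ₀)
    (pushWeight_mem_stdSimplex (fun b : A × A × A => (b.1, b.2.2)) hR.1)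
    (by rw [sum_pushWeight]; exact hR.2.2.2.1) P₀
  rw [pushWeight_pushWeight, pushWeight_pushWeight] at h
  rw [← divergence_of_ac (law₀_ac hR)]
  exact h

lemma tildeD_le_law₁ {R : A × A × A → ℝ} (hR : R ∈ couplings d Δ₀ Δ₁ P₀ P₁) :
    tildeD d Δ₁ (pushWeight (fun b => b.2.2) R) P₁ ≤ (klSum (law₁ R) P₁ : EReal) := by
  have h := tildeD_le_divergence (d := d) (Δ := Δ₁)
    (pushWeight_mem_stdSimplex (fun b : A × A × A => (b.2.1, b.2.2)) hR.1)
    (by rw [sum_pushWeight]; exact hR.2.2.2.2) P₁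
  rw [pushWeight_pushWeight, pushWeight_pushWeight] at h
  rw [← divergence_of_ac (law₁_ac hR)]
  exact h

/-- The law of `(X₀, X₁, Y)` when `X₀` and `X₁` are conditionally independent given `Y`. -/
def glue (PY : A → ℝ) (W₀ W₁ : A → A → ℝ) : A × A × A → ℝ :=
  fun b => PY b.2.2 * W₀ b.2.2 b.1 * W₁ b.2.2 b.2.1

lemma sum_glue₀ {PY : A → ℝ} {W₀ W₁ : A → A → ℝ} (h₁ : ∀ y, W₁ y ∈ stdSimplex ℝ A)
    (f : A → A → ℝ) :
    ∑ b, glue PY W₀ W₁ b * f b.1 b.2.2 = ∑ x, ∑ y, PY y * W₀ y x * f x y := by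
  simp only [glue, Fintype.sum_prod_type]
  refine sum_congr rfl fun x _ => ?_
  rw [sum_comm]
  refine sum_congr rfl fun y _ => ?_
  calc ∑ z, PY y * W₀ y x * W₁ y z * f x y = PY y * W₀ y x * f x y * ∑ z, W₁ y z := by
        rw [mul_sum]
        exact sum_congr rfl fun z _ => by ring
    _ = _ := by rw [(h₁ y).2, mul_one]

lemma sum_glue₁ {PY : A → ℝ} {W₀ W₁ : A → A → ℝ} (h₀ : ∀ y, W₀ y ∈ stdSimplex ℝ A)
    (f : A → A → ℝ) :
    ∑ b, glue PY W₀ W₁ b * f b.2.1 b.2.2 = ∑ x, ∑ y, PY y * W₁ y x * f x y := by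
  simp only [glue, Fintype.sum_prod_type]
  rw [sum_comm]
  refine sum_congr rfl fun x _ => ?_
  rw [sum_comm]
  refine sum_congr rfl fun y _ => ?_
  calc ∑ z, PY y * W₀ y z * W₁ y x * f x y = PY y * W₁ y x * f x y * ∑ z, W₀ y z := by
        rw [mul_sum]
        exact sum_congr rfl fun z _ => by ring
    _ = _ := by rw [(h₀ y).2, mul_one]

lemma sum_sum_channel {PY : A → ℝ} {W : A → A → ℝ} (hPY : PY ∈ stdSimplex ℝ A)
    (hW : ∀ y, W y ∈ stdSimplex ℝ A) (c : ℝ) : ∑ x, ∑ y, PY y * W y x * c = c := by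
  rw [sum_comm]
  simp only [← sum_mul, ← mul_sum, (hW _).2, mul_one, hPY.2, one_mul]

lemma mul_channel_eq_zero {PY : A → ℝ} {W : A → A → ℝ} (hPY : PY ∈ stdSimplex ℝ A)
    (hW : ∀ y, W y ∈ stdSimplex ℝ A) {x : A} (h : outputLaw PY W x = 0) (y : A) :
    PY y * W y x = 0 :=
  (sum_eq_zero_iff_of_nonneg fun y _ => mul_nonneg (hPY.1 y) ((hW y).1 x)).1 h y (mem_univ y)

lemma law₀_glue {PY : A → ℝ} {W₀ W₁ : A → A → ℝ} (h₁ : ∀ y, W₁ y ∈ stdSimplex ℝ A) :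
    law₀ (glue PY W₀ W₁) = outputLaw PY W₀ := by
  classical
  funext a
  have h := sum_glue₀ (PY := PY) (W₀ := W₀) h₁ fun x _ => if x = a then 1 else 0
  simp only [mul_ite, mul_one, mul_zero] at h
  rw [law₀, pushWeight, outputLaw]
  refine Eq.trans (by congr!) (h.trans ?_)
  rw [sum_comm]
  simp

lemma law₁_glue {PY : A → ℝ} {W₀ W₁ : A → A → ℝ} (h₀ : ∀ y, W₀ y ∈ stdSimplex ℝ A) :
    law₁ (glue PY W₀ W₁) = outputLaw PY W₁ := by
  classical
  funext a
  have h := sum_glue₁ (PY := PY) (W₁ := W₁) h₀ fun x _ => if x = a then 1 else 0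
  simp only [mul_ite, mul_one, mul_zero] at h
  rw [law₁, pushWeight, outputLaw]
  refine Eq.trans (by congr!) (h.trans ?_)
  rw [sum_comm]
  simp

lemma glue_mem_couplings {PY : A → ℝ} {W₀ W₁ : A → A → ℝ} (hPY : PY ∈ stdSimplex ℝ A)
    (h₀ : W₀ ∈ feasibleChannels d Δ₀ PY) (h₁ : W₁ ∈ feasibleChannels d Δ₁ PY)
    (ac₀ : ∀ a, P₀ a = 0 → outputLaw PY W₀ a = 0) (ac₁ : ∀ a, P₁ a = 0 → outputLaw PY W₁ a = 0) :
    glue PY W₀ W₁ ∈ couplings d Δ₀ Δ₁ P₀ P₁ := by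
  refine ⟨⟨fun b => ?_, ?_⟩, fun b hb => ?_, fun b hb => ?_, ?_, ?_⟩
  · exact mul_nonneg (mul_nonneg (hPY.1 _) ((h₀.1 _).1 _)) ((h₁.1 _).1 _)
  · have := sum_glue₀ (PY := PY) (W₀ := W₀) h₁.1 fun _ _ => 1
    rw [sum_sum_channel hPY h₀.1] at this
    simpa using this
  · rw [glue, mul_channel_eq_zero hPY h₀.1 (ac₀ _ hb), zero_mul]
  · rw [glue, mul_right_comm, mul_channel_eq_zero hPY h₁.1 (ac₁ _ hb), zero_mul]
  · simp only [excess₀]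
    rw [sum_glue₀ h₁.1 fun x y => d x y - Δ₀]
    simp only [mul_sub, sum_sub_distrib]
    rw [sum_sum_channel hPY h₀.1]
    exact sub_nonpos.2 h₀.2
  · simp only [excess₁]
    rw [sum_glue₁ h₀.1 fun x y => d x y - Δ₁]
    simp only [mul_sub, sum_sub_distrib]
    rw [sum_sum_channel hPY h₁.1]
    exact sub_nonpos.2 h₁.2

/-- The optimal coupling realizes the min-min problem over the laws of `Y`. -/
lemma isLeast_tildeD {lam : ℝ} {R : A × A × A → ℝ} (hR : R ∈ couplings d Δ₀ Δ₁ P₀ P₁)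
    (hRl : klSum (law₀ R) P₀ ≤ lam)
    (hmin : ∀ R' ∈ couplings d Δ₀ Δ₁ P₀ P₁, klSum (law₀ R') P₀ ≤ lam →
      klSum (law₁ R) P₁ ≤ klSum (law₁ R') P₁) :
    IsLeast ((fun PY => tildeD d Δ₁ PY P₁) ''
      {PY | PY ∈ stdSimplex ℝ A ∧ tildeD d Δ₀ PY P₀ ≤ (lam : EReal)})
      (klSum (law₁ R) P₁ : EReal) := by
  have hlb : ∀ PY ∈ stdSimplex ℝ A, tildeD d Δ₀ PY P₀ ≤ (lam : EReal) →
      (klSum (law₁ R) P₁ : EReal) ≤ tildeD d Δ₁ PY P₁ := by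
    intro PY hPY hl
    -- An empty infimum is `⊤`, contradicting the bound by the real number `lam`.
    have hne : (feasibleChannels d Δ₀ PY).Nonempty := by
      by_contra h
      rw [Set.not_nonempty_iff_eq_empty] at h
      rw [tildeD, h] at hl
      simp at hl
    obtain ⟨W₀, hW₀, hdiv⟩ := exists_channel_eq_tildeD d Δ₀ PY P₀ hne
    rw [← hdiv] at hl
    have ac₀ : ∀ a, P₀ a = 0 → outputLaw PY W₀ a = 0 := by
      by_contra h
      rw [divergence_of_not_ac h] at hl
      simp at hl
    rw [divergence_of_ac ac₀] at hl
    refine le_iInf₂ fun W₁ hW₁ => ?_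
    by_cases ac₁ : ∀ a, P₁ a = 0 → outputLaw PY W₁ a = 0
    · rw [divergence_of_ac ac₁, ← law₁_glue (W₁ := W₁) hW₀.1]
      refine EReal.coe_le_coe_iff.2 (hmin _ (glue_mem_couplings hPY hW₀ hW₁ ac₀ ac₁) ?_)
      rw [law₀_glue hW₁.1]
      exact EReal.coe_le_coe_iff.1 hl
    · rw [divergence_of_not_ac ac₁]
      exact le_top
  have hY := pushWeight_mem_stdSimplex (fun b : A × A × A => b.2.2) hR.1
  have hYl : tildeD d Δ₀ (pushWeight (fun b => b.2.2) R) P₀ ≤ (lam : EReal) :=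
    (tildeD_le_law₀ hR).trans (EReal.coe_le_coe_iff.2 hRl)
  refine ⟨⟨_, ⟨hY, hYl⟩, le_antisymm (tildeD_le_law₁ hR) (hlb _ hY hYl)⟩, ?_⟩
  rintro _ ⟨PY, ⟨hPY, hl⟩, rfl⟩
  exact hlb PY hPY hl

end SingleLetter

/-! ### The attack channel. -/

section Attack

variable {A : Type*} {n : ℕ}

lemma seqDist_comp_perm (d : A → A → ℝ) (x y : Fin n → A) (g : Equiv.Perm (Fin n)) :
    seqDist d (x ∘ g) (y ∘ g) = seqDist d x y :=
  Equiv.sum_comp g fun i => d (x i) (y i)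

lemma sum_sub_nonpos_iff (d : A → A → ℝ) (Δ : ℝ) (x y : Fin n → A) :
    ∑ i, (d (x i) (y i) - Δ) ≤ 0 ↔ seqDist d x y ≤ n * Δ := by
  rw [sum_sub_distrib, sum_const, card_univ, Fintype.card_fin, nsmul_eq_mul, sub_nonpos, seqDist]

variable [Fintype A]

lemma mem_condTypeClass {x y y' : Fin n → A} : y' ∈ condTypeClass x y ↔
    empirical (fun i => (x i, y' i)) = empirical (fun i => (x i, y i)) := by
  simp [condTypeClass]

lemma self_mem_condTypeClass (x y : Fin n → A) : y ∈ condTypeClass x y :=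
  mem_condTypeClass.2 rfl

lemma condTypeClass_eq_of_mem {x y y' : Fin n → A} (h : y' ∈ condTypeClass x y) :
    condTypeClass x y' = condTypeClass x y := by
  ext z
  rw [mem_condTypeClass, mem_condTypeClass, mem_condTypeClass.1 h]

lemma card_condTypeClass_pos (x y : Fin n → A) : 0 < ((condTypeClass x y).card : ℝ) := by
  exact_mod_cast card_pos.2 ⟨y, self_mem_condTypeClass x y⟩

variable {d : A → A → ℝ} {Δ : ℝ}

lemma attack_of_le {x y : Fin n → A} (h : seqDist d x y ≤ n * Δ) :
    attack d Δ x y = ((numAdmissible d Δ x : ℝ))⁻¹ / ((condTypeClass x y).card : ℝ) := if_pos h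

lemma attack_of_not_le {x y : Fin n → A} (h : ¬ seqDist d x y ≤ n * Δ) : attack d Δ x y = 0 :=
  if_neg h

lemma attack_nonneg (x y : Fin n → A) : 0 ≤ attack d Δ x y := by
  by_cases h : seqDist d x y ≤ n * Δ
  · rw [attack_of_le h]
    positivity
  · rw [attack_of_not_le h]

/-- Each admissible class receives at most its uniform share. The inequality also covers
`numAdmissible = 0`, where the inverse is zero. -/
lemma sum_attack_le_one (x : Fin n → A) : ∑ y, attack d Δ x y ≤ 1 := by
  classical
  set S := univ.filter fun y => seqDist d x y ≤ n * Δ with hS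
  set I := S.image fun y => condTypeClass x y with hI
  have hN : numAdmissible d Δ x = I.card := by
    unfold numAdmissible
    congr!
  have h1 : ∑ y, attack d Δ x y =
      ∑ y ∈ S, (I.card : ℝ)⁻¹ * ((condTypeClass x y).card : ℝ)⁻¹ := by
    rw [hS, sum_filter]
    refine sum_congr rfl fun y _ => ?_
    split_ifs with h
    · rw [attack_of_le h, hN, div_eq_mul_inv]
    · exact attack_of_not_le h
  have h2 : ∑ y ∈ S, ((condTypeClass x y).card : ℝ)⁻¹ ≤ I.card := by
    rw [← sum_fiberwise_of_maps_to (t := I) (g := fun y => condTypeClass x y)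
      fun y hy => mem_image_of_mem _ hy]
    calc _ ≤ ∑ c ∈ I, (1 : ℝ) := by
          refine sum_le_sum fun c hc => ?_
          obtain ⟨z, -, rfl⟩ := mem_image.1 hc
          have h3 : ∀ y ∈ S.filter fun y => condTypeClass x y = condTypeClass x z,
              ((condTypeClass x y).card : ℝ)⁻¹ = ((condTypeClass x z).card : ℝ)⁻¹ :=
            fun y hy => by rw [(mem_filter.1 hy).2]
          rw [sum_congr rfl h3, sum_const, nsmul_eq_mul, ← div_eq_mul_inv,
            div_le_one (card_condTypeClass_pos x z)]
          refine Nat.cast_le.2 (card_le_card fun y hy => ?_)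
          rw [← (mem_filter.1 hy).2]
          exact self_mem_condTypeClass x y
      _ = _ := by simp
  rw [h1, ← mul_sum]
  calc _ ≤ (I.card : ℝ)⁻¹ * I.card := by gcongr
    _ ≤ 1 := inv_mul_le_one

/-- For fixed `x`, a conditional type class is determined by the joint type, so joint types are
counted. -/
lemma numAdmissible_le (x : Fin n → A) :
    numAdmissible d Δ x ≤ (n + 1) ^ Fintype.card (A × A) := by
  classical
  unfold numAdmissible
  refine le_trans ?_ (card_image_empirical_le (B := A × A) (n := n))
  have hsub : ((univ.filter fun y : Fin n → A => seqDist d x y ≤ n * Δ).image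
      fun y => condTypeClass x y) ⊆
      (univ.image fun z : Fin n → A × A => empirical z).image
        fun t => univ.filter fun y' : Fin n → A => empirical (fun i => (x i, y' i)) = t := by
    intro c hc
    obtain ⟨y, -, rfl⟩ := mem_image.1 hc
    refine mem_image.2 ⟨_, mem_image_of_mem _ (mem_univ fun i => (x i, y i)), ?_⟩
    ext z
    rw [mem_condTypeClass]
    simp
  exact (card_le_card (by convert hsub)).trans card_image_le

lemma numAdmissible_pos {x y : Fin n → A} (h : seqDist d x y ≤ n * Δ) :
    0 < numAdmissible d Δ x := by
  classical
  unfold numAdmissible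
  exact card_pos.2 ⟨_, mem_image_of_mem _ (mem_filter.2 ⟨mem_univ y, h⟩)⟩

end Attack

/-! ### The randomized decision rule. -/

section Defence

variable {A : Type*} [Fintype A] {n : ℕ} {d : A → A → ℝ} {Δ₀ : ℝ} {P₀ : A → ℝ} {lam : ℝ}

lemma defence_zero (y : Fin n → A) : defence d Δ₀ P₀ lam 0 y =
    1 - Real.exp (-(n * (defenceRate d Δ₀ P₀ lam y).toReal)) := by
  simp [defence]

lemma toReal_defenceRate_nonneg (y : Fin n → A) : 0 ≤ (defenceRate d Δ₀ P₀ lam y).toReal :=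
  EReal.toReal_nonneg (le_max_right _ _)

lemma defence_zero_nonneg (y : Fin n → A) : 0 ≤ defence d Δ₀ P₀ lam 0 y := by
  have := toReal_defenceRate_nonneg (d := d) (Δ₀ := Δ₀) (P₀ := P₀) (lam := lam) y
  rw [defence_zero, sub_nonneg, Real.exp_le_one_iff, neg_nonpos]
  positivity

lemma defence_zero_le_one (y : Fin n → A) : defence d Δ₀ P₀ lam 0 y ≤ 1 := by
  rw [defence_zero]
  linarith [Real.exp_pos (-(n * (defenceRate d Δ₀ P₀ lam y).toReal))]

lemma exists_of_defence_zero_ne_zero {y : Fin n → A} (h : defence d Δ₀ P₀ lam 0 y ≠ 0) :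
    ∃ x : Fin n → A, seqDist d x y ≤ n * Δ₀ ∧ divergence (empirical x) P₀ < (lam : EReal) := by
  by_contra! hall
  refine h ?_
  have hinf : (lam : EReal) ≤ ⨅ x ∈ {x : Fin n → A | seqDist d x y ≤ n * Δ₀},
      divergence (empirical x) P₀ := le_iInf₂ hall
  have h0 : defenceRate d Δ₀ P₀ lam y = 0 := by
    refine max_eq_right ?_
    exact EReal.sub_nonpos.2 hinf
  rw [defence_zero, h0]
  simp

lemma le_defence_zero (hn : n ≠ 0) (hP₀ : P₀ ∈ stdSimplex ℝ A) {x y : Fin n → A} {δ : ℝ}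
    (hxy : seqDist d x y ≤ n * Δ₀) (hx : divergence (empirical x) P₀ ≤ ((lam - δ : ℝ) : EReal)) :
    1 - Real.exp (-(n * δ)) ≤ defence d Δ₀ P₀ lam 0 y := by
  set m : EReal := ⨅ x ∈ {x : Fin n → A | seqDist d x y ≤ n * Δ₀}, divergence (empirical x) P₀
    with hm
  have hm0 : 0 ≤ m := le_iInf₂ fun z _ => divergence_nonneg (empirical_mem_stdSimplex hn z) hP₀
  have hml : m ≤ ((lam - δ : ℝ) : EReal) := (iInf₂_le x hxy).trans hx
  -- The minimum lies between `0` and `lam - δ`, so it is real and `toReal` loses nothing.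
  obtain ⟨r, hr⟩ : ∃ r : ℝ, m = r := by
    refine ⟨m.toReal, (EReal.coe_toReal ?_ ?_).symm⟩
    · exact (hml.trans_lt (EReal.coe_lt_top _)).ne
    · exact (EReal.bot_lt_zero.trans_le hm0).ne'
  have hrate : defenceRate d Δ₀ P₀ lam y = ((max (lam - r) 0 : ℝ) : EReal) := by
    unfold defenceRate
    rw [← hm, hr, EReal.coe_strictMono.monotone.map_max, EReal.coe_sub, EReal.coe_zero]
  rw [hr, EReal.coe_le_coe_iff] at hml
  rw [defence_zero, hrate, EReal.toReal_coe]
  have : δ ≤ max (lam - r) 0 := le_max_of_le_left (by linarith)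
  gcongr

end Defence

/-! ### Finite block length bounds on the false-negative probability. -/

section Bounds

variable {A : Type*} [Fintype A] {n : ℕ} {d : A → A → ℝ} {Δ₀ Δ₁ : ℝ} {P₀ P₁ : A → ℝ} {lam : ℝ}

/-- The bridge from sequences to single-letter laws: per-letter distortion is the mean distortion
under the joint type. -/
lemma empirical_mem_couplings (hn : n ≠ 0) {x₀ x₁ y : Fin n → A} (h₀ : ∀ i, P₀ (x₀ i) ≠ 0)
    (h₁ : ∀ i, P₁ (x₁ i) ≠ 0) (hd₀ : seqDist d x₀ y ≤ n * Δ₀) (hd₁ : seqDist d x₁ y ≤ n * Δ₁) :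
    empirical (fun i => (x₀ i, x₁ i, y i)) ∈ couplings d Δ₀ Δ₁ P₀ P₁ := by
  have hn' : (0 : ℝ) < n := by positivity
  refine ⟨empirical_mem_stdSimplex hn _, fun b hb => ?_, fun b hb => ?_, ?_, ?_⟩
  · by_contra h
    obtain ⟨i, rfl⟩ := empirical_ne_zero_iff.1 h
    exact h₀ i hb
  · by_contra h
    obtain ⟨i, rfl⟩ := empirical_ne_zero_iff.1 h
    exact h₁ i hb
  · refine nonpos_of_mul_nonpos_right ?_ hn'
    rw [natCast_mul_sum_empirical]
    exact (sum_sub_nonpos_iff d Δ₀ x₀ y).2 hd₀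
  · refine nonpos_of_mul_nonpos_right ?_ hn'
    rw [natCast_mul_sum_empirical]
    exact (sum_sub_nonpos_iff d Δ₁ x₁ y).2 hd₁

lemma law₀_empirical (x₀ x₁ y : Fin n → A) :
    law₀ (empirical fun i => (x₀ i, x₁ i, y i)) = empirical x₀ :=
  (empirical_comp (fun b : A × A × A => b.1) fun i => (x₀ i, x₁ i, y i)).symm

lemma law₁_empirical (x₀ x₁ y : Fin n → A) :
    law₁ (empirical fun i => (x₀ i, x₁ i, y i)) = empirical x₁ :=
  (empirical_comp (fun b : A × A × A => b.2.1) fun i => (x₀ i, x₁ i, y i)).symm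

lemma equilibriumFN_le (hn : n ≠ 0) (hP₁ : P₁ ∈ stdSimplex ℝ A) {v : ℝ}
    (hv : ∀ R ∈ couplings d Δ₀ Δ₁ P₀ P₁, klSum (law₀ R) P₀ ≤ lam → v ≤ klSum (law₁ R) P₁) :
    equilibriumFN d Δ₀ Δ₁ P₀ P₁ lam n ≤ ((n : ℝ) + 1) ^ Fintype.card A * Real.exp (-(n * v)) := by
  have hterm : ∀ x y : Fin n → A, seqProb P₁ x * attack d Δ₁ x y * defence d Δ₀ P₀ lam 0 y ≤
      seqProb (empirical x) x * Real.exp (-(n * v)) * attack d Δ₁ x y := by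
    intro x y
    have hA := attack_nonneg (d := d) (Δ := Δ₁) x y
    have hpos : 0 ≤ seqProb (empirical x) x * Real.exp (-(n * v)) * attack d Δ₁ x y :=
      mul_nonneg (mul_nonneg (seqProb_nonneg (empirical_nonneg x) x) (Real.exp_pos _).le) hA
    by_cases hP : seqProb P₁ x = 0
    · simpa [hP] using hpos
    by_cases hD : defence d Δ₀ P₀ lam 0 y = 0
    · simpa [hD] using hpos
    by_cases hAt : seqDist d x y ≤ n * Δ₁
    swap
    · simp [attack_of_not_le hAt]
    obtain ⟨x₀, hx₀, hlt⟩ := exists_of_defence_zero_ne_zero hD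
    have hP' : ∀ i, P₁ (x i) ≠ 0 := fun i => prod_ne_zero_iff.1 hP i (mem_univ i)
    have ac₀ : ∀ a, P₀ a = 0 → empirical x₀ a = 0 := by
      by_contra h
      rw [divergence_of_not_ac h] at hlt
      exact not_top_lt hlt
    rw [divergence_of_ac ac₀, EReal.coe_lt_coe_iff] at hlt
    have hmem := empirical_mem_couplings hn
      (fun i h => (empirical_pos x₀ i).ne' (ac₀ _ h)) hP' hx₀ hAt
    have hvx := hv _ hmem (by rw [law₀_empirical]; exact hlt.le)
    rw [law₁_empirical] at hvx
    have hle : seqProb P₁ x ≤ seqProb (empirical x) x * Real.exp (-(n * v)) := by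
      rw [seqProb_eq_exp x fun i => lt_of_le_of_ne (hP₁.1 _) (hP' i).symm]
      have := seqProb_nonneg (empirical_nonneg x) x
      gcongr
    calc _ ≤ seqProb P₁ x * attack d Δ₁ x y * 1 :=
          mul_le_mul_of_nonneg_left (defence_zero_le_one y)
            (mul_nonneg (seqProb_nonneg hP₁.1 x) hA)
      _ ≤ _ := by
          rw [mul_one]
          gcongr
  calc equilibriumFN d Δ₀ Δ₁ P₀ P₁ lam n
      = ∑ y : Fin n → A, ∑ x : Fin n → A,
          seqProb P₁ x * attack d Δ₁ x y * defence d Δ₀ P₀ lam 0 y := by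
        simp only [equilibriumFN, falseNegative, sum_mul]
    _ ≤ ∑ y : Fin n → A, ∑ x : Fin n → A,
          seqProb (empirical x) x * Real.exp (-(n * v)) * attack d Δ₁ x y :=
        sum_le_sum fun y _ => sum_le_sum fun x _ => hterm x y
    _ = ∑ x : Fin n → A, seqProb (empirical x) x * Real.exp (-(n * v)) *
          ∑ y : Fin n → A, attack d Δ₁ x y := by
        rw [sum_comm]
        simp only [mul_sum]
    _ ≤ ∑ x : Fin n → A, seqProb (empirical x) x * Real.exp (-(n * v)) * 1 :=
        sum_le_sum fun x _ => mul_le_mul_of_nonneg_left (sum_attack_le_one x)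
          (mul_nonneg (seqProb_nonneg (empirical_nonneg x) x) (Real.exp_pos _).le)
    _ ≤ _ := by
        simp only [mul_one]
        rw [← sum_mul]
        exact mul_le_mul_of_nonneg_right (sum_seqProb_empirical_le hn) (Real.exp_pos _).le

lemma le_sum_attack_mul_defence (hn : n ≠ 0) (hP₀ : P₀ ∈ stdSimplex ℝ A) {x₀ x y : Fin n → A}
    (hd₀ : seqDist d x₀ y ≤ n * Δ₀) (hd₁ : seqDist d x y ≤ n * Δ₁) {δ : ℝ} (hδ : 0 ≤ δ)
    (hx₀ : divergence (empirical x₀) P₀ ≤ ((lam - δ : ℝ) : EReal)) :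
    (((n : ℝ) + 1) ^ Fintype.card (A × A))⁻¹ * (1 - Real.exp (-(n * δ))) ≤
      ∑ y' : Fin n → A, attack d Δ₁ x y' * defence d Δ₀ P₀ lam 0 y' := by
  have hφ : 0 ≤ 1 - Real.exp (-(n * δ)) := by
    rw [sub_nonneg, Real.exp_le_one_iff, neg_nonpos]
    positivity
  have hN : (0 : ℝ) < numAdmissible d Δ₁ x := by exact_mod_cast numAdmissible_pos hd₁
  have hN' : (numAdmissible d Δ₁ x : ℝ) ≤ ((n : ℝ) + 1) ^ Fintype.card (A × A) := by
    exact_mod_cast numAdmissible_le x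
  have hc := card_condTypeClass_pos x y
  calc _ ≤ (numAdmissible d Δ₁ x : ℝ)⁻¹ * (1 - Real.exp (-(n * δ))) := by gcongr
    _ = ∑ y' ∈ condTypeClass x y, ((numAdmissible d Δ₁ x : ℝ))⁻¹ /
          ((condTypeClass x y).card : ℝ) * (1 - Real.exp (-(n * δ))) := by
        rw [sum_const, nsmul_eq_mul]
        field_simp
    _ ≤ ∑ y' ∈ condTypeClass x y, attack d Δ₁ x y' * defence d Δ₀ P₀ lam 0 y' := by
        refine sum_le_sum fun y' hy' => ?_
        -- The permutation carrying `(x, y)` to `(x, y')` fixes `x`. Applied to `x₀` it gives a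
        -- sequence of the same type, equally close to `y'`, so the defender's bound holds on the
        -- whole class.
        obtain ⟨g, hg⟩ := exists_perm_of_empirical_eq (mem_condTypeClass.1 hy').symm
        have hgx : x = x ∘ g := funext fun i => congrArg Prod.fst (congrFun hg i)
        have hgy : y' = y ∘ g := funext fun i => congrArg Prod.snd (congrFun hg i)
        have hdist : seqDist d x y' ≤ n * Δ₁ := by
          rw [hgy, hgx, seqDist_comp_perm]
          exact hd₁
        have hdef : 1 - Real.exp (-(n * δ)) ≤ defence d Δ₀ P₀ lam 0 y' := by
          refine le_defence_zero (x := x₀ ∘ g) hn hP₀ ?_ ?_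
          · rw [hgy, seqDist_comp_perm]
            exact hd₀
          · rw [empirical_comp_perm]
            exact hx₀
        rw [attack_of_le hdist, condTypeClass_eq_of_mem hy']
        exact mul_le_mul_of_nonneg_left hdef (div_nonneg (inv_nonneg.2 hN.le) (Nat.cast_nonneg _))
    _ ≤ _ := sum_le_sum_of_subset_of_nonneg (subset_univ _)
        fun y' _ _ => mul_nonneg (attack_nonneg x y') (defence_zero_nonneg y')

lemma le_equilibriumFN (hn : n ≠ 0) (hP₀ : P₀ ∈ stdSimplex ℝ A) (hP₁ : P₁ ∈ stdSimplex ℝ A)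
    {x₀ x y : Fin n → A} (hd₀ : seqDist d x₀ y ≤ n * Δ₀) (hd₁ : seqDist d x y ≤ n * Δ₁) {δ : ℝ}
    (hδ : 0 ≤ δ) (hx₀ : divergence (empirical x₀) P₀ ≤ ((lam - δ : ℝ) : EReal))
    (hx : ∀ i, P₁ (x i) ≠ 0) :
    ((Real.exp 1 * (n + 1)) ^ Fintype.card A)⁻¹ * Real.exp (-(n * klSum (empirical x) P₁)) *
      ((((n : ℝ) + 1) ^ Fintype.card (A × A))⁻¹ * (1 - Real.exp (-(n * δ)))) ≤
      equilibriumFN d Δ₀ Δ₁ P₀ P₁ lam n := by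
  set K := (((n : ℝ) + 1) ^ Fintype.card (A × A))⁻¹ * (1 - Real.exp (-(n * δ))) with hK
  have hK0 : 0 ≤ K := by
    have : 0 ≤ 1 - Real.exp (-(n * δ)) := by
      rw [sub_nonneg, Real.exp_le_one_iff, neg_nonpos]
      positivity
    positivity
  have hT := one_le_card_typeClass_mul x
  have hT' : ((Real.exp 1 * (n + 1)) ^ Fintype.card A)⁻¹ ≤
      (typeClass x).card * seqProb (empirical x) x := by
    rw [inv_le_iff_one_le_mul₀ (by positivity), mul_comm]
    exact hT
  calc _ ≤ (typeClass x).card * seqProb (empirical x) x *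
          Real.exp (-(n * klSum (empirical x) P₁)) * K := by gcongr
    _ = ∑ x' ∈ typeClass x, seqProb P₁ x * K := by
        rw [sum_const, nsmul_eq_mul,
          seqProb_eq_exp x fun i => lt_of_le_of_ne (hP₁.1 _) (hx i).symm]
        ring
    _ ≤ ∑ x' ∈ typeClass x, seqProb P₁ x' *
          ∑ y' : Fin n → A, attack d Δ₁ x' y' * defence d Δ₀ P₀ lam 0 y' := by
        refine sum_le_sum fun x' hx' => ?_
        -- Permuting `x₀` and `y` along with `x` preserves all the hypotheses, so every member of
        -- the type class admits the same bound.
        obtain ⟨g, rfl⟩ := exists_perm_of_empirical_eq (mem_typeClass.1 hx').symm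
        rw [seqProb_comp_perm]
        refine mul_le_mul_of_nonneg_left ?_ (seqProb_nonneg hP₁.1 x)
        refine le_sum_attack_mul_defence (x₀ := x₀ ∘ g) (y := y ∘ g) hn hP₀ ?_ ?_ hδ ?_
        · rwa [seqDist_comp_perm]
        · rwa [seqDist_comp_perm]
        · rwa [empirical_comp_perm]
    _ ≤ ∑ x' : Fin n → A, seqProb P₁ x' *
          ∑ y' : Fin n → A, attack d Δ₁ x' y' * defence d Δ₀ P₀ lam 0 y' :=
        sum_le_sum_of_subset_of_nonneg (subset_univ _) fun x' _ _ =>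
          mul_nonneg (seqProb_nonneg hP₁.1 x') (sum_nonneg fun y' _ =>
            mul_nonneg (attack_nonneg x' y') (defence_zero_nonneg y'))
    _ = _ := by
        simp only [equilibriumFN, falseNegative, mul_sum]
        rw [sum_comm]
        refine sum_congr rfl fun y' _ => ?_
        rw [sum_mul]
        simp only [mul_assoc]

end Bounds

/-! ### Passage to the limit. -/

section Asymptotics

lemma tendsto_log_succ_div : Tendsto (fun n : ℕ => Real.log ((n : ℝ) + 1) / n) atTop (𝓝 0) := by
  have h := (Real.tendsto_pow_log_div_mul_add_atTop 1 (-1) 1 one_ne_zero).comp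
    (tendsto_atTop_add_const_right atTop (1 : ℝ) tendsto_natCast_atTop_atTop)
  refine h.congr fun n => ?_
  simp

lemma errorExponent_eq {p : ℕ → ℝ} {v : ℝ} (hp : ∀ᶠ n in atTop, 0 < p n)
    (h : Tendsto (fun n : ℕ => -(1 / (n : ℝ) * Real.log (p n))) atTop (𝓝 v)) :
    errorExponent p = v := by
  have h1 : Tendsto (fun n : ℕ => ((Real.log (p n) / n : ℝ) : EReal)) atTop (𝓝 ((-v : ℝ) : EReal)) := by
    refine (continuous_coe_real_ereal.tendsto _).comp (h.neg.congr fun n => ?_)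
    ring
  have h2 : (fun n : ℕ => ((Real.log (p n) / n : ℝ) : EReal)) =ᶠ[atTop]
      fun n : ℕ => ENNReal.log (ENNReal.ofReal (p n)) / ((n : ℝ) : EReal) := by
    filter_upwards [hp] with n hn
    rw [ENNReal.log_ofReal_of_pos hn, EReal.coe_div]
  rw [errorExponent, (h1.congr' h2).limsup_eq, EReal.coe_neg, neg_neg]

variable {A : Type*} [Fintype A] {d : A → A → ℝ} {Δ₀ Δ₁ : ℝ} {P₀ P₁ : A → ℝ} {lam : ℝ}

/-- Types of sequences over the support of `Q` meet the distortion constraint eventually. -/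
lemma StrictOrTight.eventually_sum_nonpos {c Q : A × A × A → ℝ} (h : StrictOrTight c Q)
    {s : ∀ n : ℕ, Fin n → A × A × A} (hs : ∀ n i, Q (s n i) ≠ 0)
    (hlim : Tendsto (fun n => empirical (s n)) atTop (𝓝 Q)) :
    ∀ᶠ n in atTop, ∑ i, c (s n i) ≤ 0 := by
  rcases h with h | h
  · have hcont : Continuous fun R : A × A × A → ℝ => ∑ b, R b * c b := by fun_prop
    filter_upwards [((hcont.tendsto Q).comp hlim).eventually_lt_const h] with n hn
    rw [← natCast_mul_sum_empirical]
    exact mul_nonpos_of_nonneg_of_nonpos (Nat.cast_nonneg n) hn.le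
  · exact Eventually.of_forall fun n => (sum_eq_zero fun i _ => h _ (hs n i)).le

lemma eventually_le_equilibriumFN (hP₀ : P₀ ∈ stdSimplex ℝ A) (hP₁ : P₁ ∈ stdSimplex ℝ A)
    {Q : A × A × A → ℝ} (hQ : Q ∈ couplings d Δ₀ Δ₁ P₀ P₁) (hQl : klSum (law₀ Q) P₀ < lam)
    (h₀ : StrictOrTight (excess₀ d Δ₀) Q) (h₁ : StrictOrTight (excess₁ d Δ₁) Q) {r : ℝ}
    (hr : klSum (law₁ Q) P₁ < r) :
    ∀ᶠ n : ℕ in atTop,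
      ((Real.exp 1 * (n + 1)) ^ Fintype.card A)⁻¹ * Real.exp (-(n * r)) *
        ((((n : ℝ) + 1) ^ Fintype.card (A × A))⁻¹ * (1 / 2)) ≤
      equilibriumFN d Δ₀ Δ₁ P₀ P₁ lam n := by
  obtain ⟨s, hs, hlim⟩ := exists_tendsto_empirical hQ.1
  obtain ⟨μ, hμ, hμl⟩ := exists_between hQl
  -- The margin `δ` makes the acceptance probability at least `1 - exp(-nδ)`, eventually at least
  -- `1/2`.
  set δ := lam - μ with hδ
  have hδ0 : 0 < δ := sub_pos.2 hμl
  have hexp : Tendsto (fun n : ℕ => Real.exp (-(n * δ))) atTop (𝓝 0) :=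
    Real.tendsto_exp_neg_atTop_nhds_zero.comp
      (tendsto_natCast_atTop_atTop.atTop_mul_const hδ0)
  filter_upwards [eventually_ne_atTop 0, h₀.eventually_sum_nonpos hs hlim,
    h₁.eventually_sum_nonpos hs hlim,
    ((continuous_klSum_law₀.tendsto Q).comp hlim).eventually_lt_const hμ,
    ((continuous_klSum_law₁.tendsto Q).comp hlim).eventually_lt_const hr,
    hexp.eventually_le_const (by norm_num : (0 : ℝ) < 1 / 2)] with n hn e₀ e₁ k₀ k₁ hφ
  simp only [Function.comp_apply] at k₀ k₁
  have hl₀ : law₀ (empirical (s n)) = empirical fun i => (s n i).1 :=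
    (empirical_comp (fun b : A × A × A => b.1) (s n)).symm
  have hl₁ : law₁ (empirical (s n)) = empirical fun i => (s n i).2.1 :=
    (empirical_comp (fun b : A × A × A => b.2.1) (s n)).symm
  rw [hl₀] at k₀
  rw [hl₁] at k₁
  have hx₁ : ∀ i, P₁ (s n i).2.1 ≠ 0 := fun i h => hs n i (hQ.2.2.1 _ h)
  have hac : ∀ a, P₀ a = 0 → empirical (fun i => (s n i).1) a = 0 := fun a ha => by
    by_contra h
    obtain ⟨i, rfl⟩ := empirical_ne_zero_iff.1 h
    exact hs n i (hQ.2.1 _ ha)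
  have hdiv : divergence (empirical fun i => (s n i).1) P₀ ≤ ((lam - δ : ℝ) : EReal) := by
    rw [divergence_of_ac hac, EReal.coe_le_coe_iff, hδ, sub_sub_cancel]
    exact k₀.le
  refine le_trans ?_ (le_equilibriumFN hn hP₀ hP₁ ((sum_sub_nonpos_iff d Δ₀ _ _).1 e₀)
    ((sum_sub_nonpos_iff d Δ₁ _ _).1 e₁) hδ0.le hdiv hx₁)
  have hφ' : 1 / 2 ≤ 1 - Real.exp (-(n * δ)) := by linarith
  have hk := k₁.le
  gcongr

/-- The exponential rate of the false-negative probability is the optimal divergence. -/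
lemma tendsto_equilibriumFN (hP₀ : P₀ ∈ stdSimplex ℝ A) (hP₁ : P₁ ∈ stdSimplex ℝ A)
    (hac : ∀ a, P₁ a = 0 → P₀ a = 0)
    (hΔ₀ : ∀ a, ∃ b, d a b ≤ Δ₀) (hΔ₁ : ∀ a, ∃ b, d a b ≤ Δ₁) (hlam : 0 < lam)
    {R : A × A × A → ℝ} (hR : R ∈ couplings d Δ₀ Δ₁ P₀ P₁) (hRl : klSum (law₀ R) P₀ ≤ lam)
    (hmin : ∀ R' ∈ couplings d Δ₀ Δ₁ P₀ P₁, klSum (law₀ R') P₀ ≤ lam →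
      klSum (law₁ R) P₁ ≤ klSum (law₁ R') P₁) :
    (∀ᶠ n : ℕ in atTop, 0 < equilibriumFN d Δ₀ Δ₁ P₀ P₁ lam n) ∧
      Tendsto (fun n : ℕ => -(1 / (n : ℝ) * Real.log (equilibriumFN d Δ₀ Δ₁ P₀ P₁ lam n)))
        atTop (𝓝 (klSum (law₁ R) P₁)) := by
  have hlow : ∀ r, klSum (law₁ R) P₁ < r → ∀ᶠ n : ℕ in atTop,
      ((Real.exp 1 * (n + 1)) ^ Fintype.card A)⁻¹ * Real.exp (-(n * r)) *
        ((((n : ℝ) + 1) ^ Fintype.card (A × A))⁻¹ * (1 / 2)) ≤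
      equilibriumFN d Δ₀ Δ₁ P₀ P₁ lam n := fun r hr => by
    obtain ⟨Q, hQ, hQl, hQr, hQ₀, hQ₁⟩ :=
      exists_regular_coupling hP₀ hac hΔ₀ hΔ₁ hlam hR hRl hr
    exact eventually_le_equilibriumFN hP₀ hP₁ hQ hQl hQ₀ hQ₁ hQr
  have hpos : ∀ᶠ n : ℕ in atTop, 0 < equilibriumFN d Δ₀ Δ₁ P₀ P₁ lam n :=
    (hlow _ (lt_add_one _)).mono fun n hn => lt_of_lt_of_le (by positivity) hn
  refine ⟨hpos, tendsto_order.2 ⟨fun l hl => ?_, fun u hu => ?_⟩⟩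
  · have hlim : Tendsto (fun n : ℕ => klSum (law₁ R) P₁ -
        Fintype.card A * (Real.log ((n : ℝ) + 1) / n)) atTop
        (𝓝 (klSum (law₁ R) P₁ - Fintype.card A * 0)) :=
      tendsto_const_nhds.sub (tendsto_log_succ_div.const_mul _)
    rw [mul_zero, sub_zero] at hlim
    filter_upwards [hpos, eventually_ne_atTop 0, hlim.eventually_const_lt hl] with n hp hn hln
    refine hln.trans_le ?_
    have hn' : (0 : ℝ) < n := by positivity
    have h := Real.log_le_log hp (equilibriumFN_le hn hP₁ hmin)
    rw [Real.log_mul (by positivity) (by positivity), Real.log_exp, Real.log_pow] at h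
    have h' := div_le_div_of_nonneg_right h hn'.le
    have e : (Fintype.card A * Real.log ((n : ℝ) + 1) + -(n * klSum (law₁ R) P₁)) / n =
        Fintype.card A * (Real.log ((n : ℝ) + 1) / n) - klSum (law₁ R) P₁ := by
      field_simp
      ring
    rw [e] at h'
    rw [one_div, inv_mul_eq_div]
    linarith
  -- Regularized couplings achieve only rates strictly above the optimum, hence the intermediate
  -- `r`; the polynomial factors vanish after division by `n`.
  · obtain ⟨r, hr, hru⟩ := exists_between hu
    have hlim : Tendsto (fun n : ℕ => r + (Fintype.card A + Fintype.card (A × A)) *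
        (Real.log ((n : ℝ) + 1) / n) + (Fintype.card A + Real.log 2) * ((n : ℝ)⁻¹)) atTop
        (𝓝 (r + (Fintype.card A + Fintype.card (A × A)) * 0 +
          (Fintype.card A + Real.log 2) * 0)) :=
      (tendsto_const_nhds.add (tendsto_log_succ_div.const_mul _)).add
        (tendsto_inv_atTop_nhds_zero_nat.const_mul _)
    rw [mul_zero, mul_zero, add_zero, add_zero] at hlim
    filter_upwards [hlow r hr, eventually_ne_atTop 0, hlim.eventually_lt_const hru]
      with n hp hn hln
    refine lt_of_le_of_lt ?_ hln
    have hn' : (0 : ℝ) < n := by positivity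
    have h := Real.log_le_log (by positivity) hp
    rw [Real.log_mul (by positivity) (by positivity), Real.log_mul (by positivity) (by positivity),
      Real.log_mul (by positivity) (by positivity), Real.log_inv, Real.log_inv, Real.log_pow,
      Real.log_pow, Real.log_mul (by positivity) (by positivity), Real.log_exp, Real.log_exp,
      one_div, Real.log_inv] at h
    have h' := div_le_div_of_nonneg_right h hn'.le
    rw [one_div, inv_mul_eq_div]
    refine le_trans (neg_le_neg h') (le_of_eq ?_)
    field_simp
    ring

end Asymptotics

end DetectionGame

theorem theorem3 {A : Type*} [Fintype A]
    (d : A → A → ℝ) (hd : ∀ a b, 0 ≤ d a b)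
    (P₀ P₁ : A → ℝ) (hP₀ : P₀ ∈ stdSimplex ℝ A) (hP₁ : P₁ ∈ stdSimplex ℝ A)
    (hac : ∀ a, P₁ a = 0 → P₀ a = 0)
    (Δ₀ Δ₁ : ℝ) (hΔ₀ : ∀ a, ∃ b, d a b ≤ Δ₀) (hΔ₁ : ∀ a, ∃ b, d a b ≤ Δ₁)
    (lam : ℝ) (hlam : 0 < lam) :
    ∃ v : ℝ,
      IsLeast ((fun PY => DetectionGame.tildeD d Δ₁ PY P₁) ''
        {PY | PY ∈ stdSimplex ℝ A ∧ DetectionGame.tildeD d Δ₀ PY P₀ ≤ (lam : EReal)}) (v : EReal) ∧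
      (∀ᶠ n : ℕ in atTop, 0 < DetectionGame.equilibriumFN d Δ₀ Δ₁ P₀ P₁ lam n) ∧
      Tendsto (fun n : ℕ =>
        -(1 / (n : ℝ) * Real.log (DetectionGame.equilibriumFN d Δ₀ Δ₁ P₀ P₁ lam n)))
        atTop (𝓝 v) ∧
      DetectionGame.errorExponent (DetectionGame.equilibriumFN d Δ₀ Δ₁ P₀ P₁ lam) = (v : EReal) ∧
      (∀ PY ∈ stdSimplex ℝ A, (DetectionGame.feasibleChannels d Δ₀ PY).Nonempty →
        ∃ W ∈ DetectionGame.feasibleChannels d Δ₀ PY,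
          DetectionGame.divergence (DetectionGame.outputLaw PY W) P₀ =
            DetectionGame.tildeD d Δ₀ PY P₀) ∧
      (∀ PY ∈ stdSimplex ℝ A, (DetectionGame.feasibleChannels d Δ₁ PY).Nonempty →
        ∃ W ∈ DetectionGame.feasibleChannels d Δ₁ PY,
          DetectionGame.divergence (DetectionGame.outputLaw PY W) P₁ =
            DetectionGame.tildeD d Δ₁ PY P₁) := by
  obtain ⟨R, hR, hRl, hmin⟩ :=
    DetectionGame.exists_optimal_coupling hP₀ hac hΔ₀ hΔ₁ hlam
  obtain ⟨hpos, hlim⟩ :=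
    DetectionGame.tendsto_equilibriumFN hP₀ hP₁ hac hΔ₀ hΔ₁ hlam hR hRl hmin
  exact ⟨_, DetectionGame.isLeast_tildeD hR hRl hmin, hpos, hlim,
    DetectionGame.errorExponent_eq hpos hlim,
    fun PY _ => DetectionGame.exists_channel_eq_tildeD d Δ₀ PY P₀,
    fun PY _ => DetectionGame.exists_channel_eq_tildeD d Δ₁ PY P₁⟩
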